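/- **Setting.** Let $d\ge 1$, $\mathbb I=[0,1]$, and let $\mathcal C_d$ be the space of continuous paths $x:\mathbb I\to\mathbb R^d$ with the uniform norm. A *signal* ($\mu\in\mathfrak D$) is a Borel probability measure on $\mathcal C_d$ supported on the absolutely continuous paths. For a word $w=i_1\cdots i_m$ in $\{1,\dots,d\}$ let $\mathfrak{sig}_w(x)=\int_{0\le t_1\le\cdots\le t_m\le 1}dx^{i_1}_{t_1}\cdots dx^{i_m}_{t_m}$ and $\langle\mu\rangle_w=\int\mathfrak{sig}_w\,d\mu$. Let $\dot{\mathfrak D}$ be the set of signals for which all $\langle\mu\rangle_w$ with $|w|=2,3$ exist in $\mathbb R$ and $\langle\mu\rangle_{ii}\ne 0$ for all $i$. Put $[\mu]_0=(\langle\mu\rangle_{ij})_{i,j}$, $[\mu]_\nu=(\langle\mu\rangle_{ij\nu})_{i,j}$ for $1\le\nu\le d$, $[\mu]_{\mathfrak c}=([\mu]_0,\dots,[\mu]_d)\in\mathcal V:=(\mathbb R^{d\times d})^{d+1}$, and $C_\mu=\frac12([\mu]_0+[\mu]_0^{\intercal})$. For a matrix $B$ let $B\cdot\mu$ be the image of $\mu$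 under $(x_t)\mapsto(Bx_t)$. $|\cdot|$ is the Euclidean norm on $\mathbb R^d$; for matrices $\|\cdot\|$ is the Frobenius norm, $\|\cdot\|_\infty$ the maximal absolute row sum, $\kappa_2(B)=\|B\|_2\|B^{-1}\|_2$ the spectral condition number. On $\mathcal V$, $\|v\|=(\sum_\nu\|v_\nu\|^2)^{1/2}$ and $\|v\|_\infty$ is the maximum of the absolute values of all entries. $\mathrm M_d$ is the set of monomial matrices (invertible diagonal matrix times permutation matrix). For $s\in(0,\infty)^d$, $N=\operatorname{diag}(\sqrt{s_1},\dots,\sqrt{s_d})$ and $v\in\mathcal V$ put $\mathsf N_s(v)=\big(N^{-1}v_0N^{-1},\,N^{-1}\tfrac{v_1}{\sqrt{s_1}}N^{-1},\dots,N^{-1}\tfrac{v_d}{\sqrt{s_d}}N^{-1}\big)$, and let $s(\mu)=(\langle\mu\rangle_{11},\dots,\langle\mu\rangle_{dd})$. Define $$\varphi_\mu(v)=\big\|\mathsf N_{s(\mu)}(v-[\mu]_{\mathfrak c})\big\|,\qquad \delta(\mu,\mu')=\varphi_\mu([\mu']_{\mathfrak c}).$$ *Inversion map.* Let $R_{(\mu)}=(C_\mu^{-1})^{1/2}$.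 The contrast is $\phi_\mu(\theta)=\sum_{\nu=0}^d\|\mathfrak x_\nu\|_\times^2$, where $(\mathfrak x_0,\dots,\mathfrak x_d)=\mathsf N_{s(\mu')}([\mu']_{\mathfrak c})$ for $\mu'=(\theta R_{(\mu)})\cdot\mu$, and $\|\cdot\|_\times$ is the Frobenius norm of the off-diagonal part. For $\tilde\kappa_0>0$ let $\tilde\Xi_1$ be the set of invertible $\theta\in\mathbb R^{d\times d}$ with rows of Euclidean norm $1$ and $\kappa_2(\theta)\le\tilde\kappa_0$, and $$\hat\Phi(\mu)=\Big[\operatorname*{argmin}_{\theta\in\tilde\Xi_1}\phi_\mu(\theta)\Big]\cdot R_{(\mu)} .$$ *Deviance.* For $\mu\in\dot{\mathfrak D}$ let $D_\mu$ be its spatial support (the closure of the union over $t\in\mathbb I$ of the supports of the laws of $x_t$ under $\mu$). For an invertible matrix $A$ put $$\partial_{\hat\Phi}(\mu,A)=\sup_{B\in\hat\Phi(A\cdot\mu)}\ \inf_{M\in\mathrm M_d,\,v\in\mathbb R^d}\ \sup_{u\in v+D_\mu}\frac{|BA(u-v)-Mu|}{|Mu|}$$ (the quotient read as $0$ where $Mu=0$).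 *Source and observable.* Let $\bm S=(\bm S_t)_{t\in\mathbb I}$ be a stochastic process in $\mathbb R^d$ on a probability space $(\Omega,\mathscr F,\mathbb P)$ with law $S\in\dot{\mathfrak D}$ such that $C_S$ is invertible, $\langle S\rangle_{ij}=0$ unless $i=j$, $\langle S\rangle_{ijk}=0$ unless $i=j=k$, and $\langle S\rangle_{iii}=0$ for at most one $i$. Let $A$ be an invertible $d\times d$ matrix, $\bm X=A\bm S$ almost surely, and $X$ the law of $\bm X$. Let $\bar B_{(A,S)}$ be the matrix $(R_{(X)}A)^{-1}$ with its rows scaled to Euclidean norm $1$, fix $\Delta_\kappa>0$, and use $\tilde\kappa_0=\kappa_2(\bar B_{(A,S)})+\Delta_\kappa$ in $\hat\Phi$. *Rate.* Let $\hat\mu_n$ ($n\in\mathbb N$) be random measures that are almost surely in $\dot{\mathfrak D}$, let $(\tilde\alpha_n)$ be a strictly decreasing null sequence and $\gamma_n=\max_{|w|=2,3}|\langle\hat\mu_n\rangle_w-\langle X\rangle_w|$. Assume $\gamma_n=O_P(\tilde\alpha_n)$: for each $\epsilon>0$ there are $0<m_\epsilon,M_\epsilon<\infty$ with $$\sup_{n\ge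 m_\epsilon}\mathbb P(\gamma_n\ge M_\epsilon\tilde\alpha_n)\le\epsilon.\tag{1}$$ **Proposition.** There are constants $\tilde c_0,\dots,\tilde c_4>0$, depending only on $(S,A,\tilde\kappa_0)$, such that (a) and (b) hold with $\tilde\delta(\varepsilon)=\min\{\tilde c_0,\ \tilde c_1^2(\varepsilon/(\tilde c_2+\varepsilon))^2\}$. (a) For every $\varepsilon>0$ and every $\mu\in\dot{\mathfrak D}$ with $\delta(S,\mu)<\tilde\delta(\varepsilon)$: each $\theta\in\hat\Phi(A\cdot\mu)$ is of the form $\theta=M(\mathrm I+E)A^{-1}$ with $M\in\mathrm M_d$, $\|M\|\le\tilde c_3$ and $\|E\|\le\varepsilon$; and $\partial_{\hat\Phi}(\mu,A)\le\tilde c_4\varepsilon$. (b) For every $(\Omega,\mathscr F,\mathbb P)$, $\bm S$, $\bm X$, $(\hat\mu_n)$, $(\tilde\alpha_n)$ as above, every $\varepsilon>0$ and every $0\le q<1$ there is a threshold $n_0\in\mathbb N$ such that for each $n\ge n_0$ the following holds with probability at least $q$: $$\text{for every }\hat\theta\in\hat\Phi(\hat\mu_n)\text{ there is }M\in\mathrm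 M_d\text{ such that }\sup_{t\in\mathbb I:\,\bm S_t\ne0}\frac{|\hat\theta\bm X_t-M\bm S_t|}{|M\bm S_t|}\le\varepsilon .$$ Explicitly, for any $m_{1-q},M_{1-q}\in(0,\infty)$ that satisfy (1) with $\epsilon=1-q$, the minimum $$n_0=\min\left\{n\ge m_{1-q}\ \middle|\ \tilde\alpha_n<\frac{\eta(\tilde\delta(\varepsilon/\tilde c_4))}{(1+\|A^{-1}\|_\infty)^3M_{1-q}}\right\}$$ exists and is such a threshold. Here $\eta=\omega_\varphi^{-1}:\mathbb R_+\to\mathbb R_+$ is the inverse of $\omega_\varphi(r)=\sup\{\varphi_S(v)\mid v\in\mathcal V,\ \|v-[S]_{\mathfrak c}\|_\infty\le r\}$. -/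

import Mathlib

open MeasureTheory Set Filter Topology
open scoped ENNReal

noncomputable section

namespace SigICA

/-! ### Path space, linear action and signals -/

/-- Euclidean space `ℝᵈ`. -/
abbrev Eucl (d : ℕ) : Type := EuclideanSpace ℝ (Fin d)

/-- Real `d × d` matrices. -/
abbrev Mat (d : ℕ) : Type := Matrix (Fin d) (Fin d) ℝ

/-- The space of continuous paths `[0,1] → ℝᵈ` with the uniform norm. -/
abbrev PathSpace (d : ℕ) : Type := C(unitInterval, Eucl d)

/-- Path space carries its Borel σ-algebra (of the uniform topology). -/
instance instMeasurableSpacePathSpace (d : ℕ) : MeasurableSpace (PathSpace d) :=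
  borel (PathSpace d)

instance instBorelSpacePathSpace (d : ℕ) : BorelSpace (PathSpace d) := ⟨rfl⟩

variable {d : ℕ}

/-- Matrix-vector product on Euclidean space, as a continuous linear map. -/
def mv (A : Mat d) : Eucl d →L[ℝ] Eucl d := Matrix.toEuclideanCLM (n := Fin d) (𝕜 := ℝ) A

/-- The pointwise action `(x_t) ↦ (A x_t)` of a matrix on a path. -/
def pathAct (A : Mat d) (x : PathSpace d) : PathSpace d :=
  (⟨fun u => mv A u, (mv A).continuous⟩ : C(Eucl d, Eucl d)).comp x

/-- The action `A · μ` of a matrix on a law on path space, by pushforward. -/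
def act (A : Mat d) (μ : Measure (PathSpace d)) : Measure (PathSpace d) :=
  μ.map (pathAct A)

/-- The path as a function on `ℝ` (extended constantly outside of `[0,1]`). -/
def ext (x : PathSpace d) : ℝ → Eucl d := Set.IccExtend (zero_le_one' ℝ) (⇑x)

/-- Absolute continuity of a path. -/
def IsACPath (x : PathSpace d) : Prop := AbsolutelyContinuousOnInterval (ext x) 0 1

/-- Signals: Borel probability measures on path space that are supported on the absolutely
continuous paths. -/
def IsSignal (μ : Measure (PathSpace d)) : Prop :=
  IsProbabilityMeasure μ ∧ ∀ᵐ x ∂μ, IsACPath x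

/-! ### Signature moments and coredinates -/

/-- Running iterated integral of `x` over `{0 ≤ t₁ ≤ ⋯ ≤ t_m ≤ t}`, the letters of the word being
listed from the outermost differential to the innermost one. For an absolutely continuous path
the Lebesgue-Stieltjes differential `dxⁱ_s` is `ẋⁱ_s ds`. -/
def runningIntegral (x : PathSpace d) : List (Fin d) → ℝ → ℝ
  | [], _ => 1
  | i :: w, t => ∫ s in (0 : ℝ)..t, runningIntegral x w s * deriv (fun r => ext x r i) s

/-- The signature coefficient
`sig_{i₁⋯i_m}(x) = ∫_{0 ≤ t₁ ≤ ⋯ ≤ t_m ≤ 1} dx^{i₁}_{t₁} ⋯ dx^{i_m}_{t_m}` for the word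
`w = [i₁, …, i_m]`. -/
def sig (w : List (Fin d)) (x : PathSpace d) : ℝ := runningIntegral x w.reverse 1

/-- The signature moment `⟨μ⟩_w`. -/
def sigMoment (μ : Measure (PathSpace d)) (w : List (Fin d)) : ℝ := ∫ x, sig w x ∂μ

/-- The coordinate space of `(d+1)`-tuples of `d × d` matrices. -/
abbrev CoSpace (d : ℕ) : Type := Fin (d + 1) → Mat d

/-- The coredinates `[μ]_c = ([μ]_0, [μ]_1, …, [μ]_d)`, with `[μ]_0 = (⟨μ⟩_{ij})` and
`[μ]_ν = (⟨μ⟩_{ijν})`; the entries are precisely the signature moments of orders 2 and 3. -/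
def coredinates (μ : Measure (PathSpace d)) : CoSpace d :=
  Fin.cons (Matrix.of fun i j => sigMoment μ [i, j])
    (fun ν => Matrix.of fun i j => sigMoment μ [i, j, ν])

/-- The second-order diagonal moments `⟨μ⟩_{ii}`. -/
def diagMoment (μ : Measure (PathSpace d)) (i : Fin d) : ℝ := sigMoment μ [i, i]

/-- The coredinatisable signals: all signature moments of orders 2 and 3 exist in `ℝ`, and the
diagonal ones of order 2 do not vanish. -/
def IsCoSignal (μ : Measure (PathSpace d)) : Prop :=
  IsSignal μ ∧ (∀ w : List (Fin d), w.length = 2 ∨ w.length = 3 → Integrable (sig w) μ) ∧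
    ∀ i, diagMoment μ i ≠ 0

/-- The symmetrised second-order coredinate `C_μ = ½([μ]_0 + [μ]_0ᵀ)`. -/
def covMat (μ : Measure (PathSpace d)) : Mat d :=
  (1 / 2 : ℝ) • (coredinates μ 0 + (coredinates μ 0).transpose)

/-- Third-order orthogonality: `⟨μ⟩_{ij} = 0` unless `i = j`, and `⟨μ⟩_{ijk} = 0` unless
`i = j = k`. -/
def IsOrthogonal (μ : Measure (PathSpace d)) : Prop :=
  (∀ i j, i ≠ j → sigMoment μ [i, j] = 0) ∧
    ∀ i j k, ¬ (i = j ∧ j = k) → sigMoment μ [i, j, k] = 0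

/-- The identifiable sources: orthogonal coredinatisable signals `μ` with invertible `C_μ`
such that `⟨μ⟩_{iii}` vanishes for at most one index `i`. -/
def IsIdentifiableSource (μ : Measure (PathSpace d)) : Prop :=
  IsCoSignal μ ∧ IsUnit (covMat μ).det ∧ {i : Fin d | sigMoment μ [i, i, i] = 0}.ncard ≤ 1 ∧
    IsOrthogonal μ

/-! ### Norms -/

/-- Frobenius norm of a matrix. -/
def frobNorm (B : Mat d) : ℝ := √(∑ i, ∑ j, B i j ^ 2)

/-- Spectral condition number `κ₂(B) = ‖B‖₂ ‖B⁻¹‖₂`. -/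
def cond2 (B : Mat d) : ℝ := ‖mv B‖ * ‖mv B⁻¹‖

/-- The operator norm `‖B‖_∞` of a matrix that is induced by the maximum norm, that is, the
maximal absolute row sum. -/
def rowSumNorm (B : Mat d) : ℝ := ⨆ i, ∑ j, |B i j|

/-- The `ℓ₂`-norm on coordinate space derived from the Frobenius norm. -/
def coNorm (v : CoSpace d) : ℝ := √(∑ ν, frobNorm (v ν) ^ 2)

/-- The maximum norm on coordinate space. -/
def coSupNorm (v : CoSpace d) : ℝ := ⨆ p : Fin (d + 1) × Fin d × Fin d, |v p.1 p.2.1 p.2.2|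

/-! ### The premetric -/

/-- For positive weights `s` and `N = diag(√s₁, …, √s_d)`, the tuple
`(N⁻¹ v₀ N⁻¹, N⁻¹ (v₁ / √s₁) N⁻¹, …, N⁻¹ (v_d / √s_d) N⁻¹)`. -/
def standardise (s : Fin d → ℝ) (v : CoSpace d) : CoSpace d :=
  let N : Mat d := Matrix.diagonal fun i => (√(s i))⁻¹
  Fin.cons (N * v 0 * N) (fun ν => N * ((√(s ν))⁻¹ • v ν.succ) * N)

/-- The function `φ_μ` on coordinate space with `δ(μ, μ') = φ_μ([μ']_c)`. -/
def premetricFun (μ : Measure (PathSpace d)) (v : CoSpace d) : ℝ :=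
  coNorm (standardise (diagMoment μ) (v - coredinates μ))

/-- The premetric `δ(μ, μ')`. -/
def premetric (μ μ' : Measure (PathSpace d)) : ℝ := premetricFun μ (coredinates μ')

/-- The modulus of continuity `ω(r) = sup {φ_μ(v) | ‖v - [μ]_c‖_∞ ≤ r}` of `φ_μ` at `[μ]_c`. -/
def modulus (μ : Measure (PathSpace d)) (r : ℝ) : ℝ :=
  sSup {y | ∃ v : CoSpace d, coSupNorm (v - coredinates μ) ≤ r ∧ y = premetricFun μ v}

/-- The inverse `η = ω⁻¹ : ℝ₊ → ℝ₊` of the modulus of continuity. -/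
def invModulus (μ : Measure (PathSpace d)) : ℝ → ℝ :=
  Function.invFunOn (modulus μ) (Set.Ici 0)

/-! ### The inversion map -/

open scoped MatrixOrder in
/-- The whitening matrix `R_(μ) = (C_μ⁻¹)^{1/2}` (positive semidefinite square root). -/
def whitening (μ : Measure (PathSpace d)) : Mat d := CFC.sqrt (covMat μ)⁻¹

/-- The normalised statistics of `μ`, so that `𝔵_ν(θ)` is `normStat (θ · μ) ν`. -/
def normStat (μ : Measure (PathSpace d)) : CoSpace d :=
  standardise (diagMoment μ) (coredinates μ)

/-- The contrast `φ_μ(θ) = ∑_{ν=0}^d ‖𝔵_ν(θ R_(μ))‖_×²`, where `‖B‖_×` is the Frobenius norm of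
the off-diagonal part of `B`. -/
def contrast (μ : Measure (PathSpace d)) (θ : Mat d) : ℝ :=
  ∑ ν, frobNorm (normStat (act (θ * whitening μ) μ) ν -
    Matrix.diagonal (normStat (act (θ * whitening μ) μ) ν).diag) ^ 2

/-- Invertible matrices with unit rows and spectral condition number at most `κ`. -/
def searchDomain (d : ℕ) (κ : ℝ) : Set (Mat d) :=
  {θ | (∀ i, ∑ j, θ i j ^ 2 = 1) ∧ IsUnit θ.det ∧ cond2 θ ≤ κ}

/-- The inversion map `Φ̂(μ) = [argmin_{θ ∈ Ξ} φ_μ(θ)] · R_(μ)`, where `Ξ` is the search domain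
with condition bound `κ`. -/
def inversion (κ : ℝ) (μ : Measure (PathSpace d)) : Set (Mat d) :=
  {B | ∃ θ ∈ searchDomain d κ, (∀ θ' ∈ searchDomain d κ, contrast μ θ ≤ contrast μ θ') ∧
    B = θ * whitening μ}

/-- The matrix `(R_(Aμ) A)⁻¹`, rescaled to unit rows. -/
def unitRowUnmixing (A : Mat d) (μ : Measure (PathSpace d)) : Mat d :=
  let B : Mat d := (whitening (act A μ) * A)⁻¹
  Matrix.diagonal (fun i => (√(∑ j, B i j ^ 2))⁻¹) * B

/-- Monomial matrices: products `D P` of an invertible diagonal and a permutation matrix. -/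
def IsMonomial (M : Mat d) : Prop :=
  ∃ (a : Fin d → ℝ) (σ : Equiv.Perm (Fin d)),
    (∀ i, a i ≠ 0) ∧ M = Matrix.diagonal a * σ.permMatrix ℝ

/-! ### Deviance and the constants of the robustness theorem -/

/-- The spatial support of a law on path space. -/
def spatialSupport (μ : Measure (PathSpace d)) : Set (Eucl d) :=
  closure (⋃ t : unitInterval, (μ.map fun x => x t).support)

/-- The deviance of the inversion map at the cause `(μ, A)`:
`sup_B inf_{(M,v)} sup_{u ∈ v + D_μ} |B A (u - v) - M u| / |M u|`, with `B` in `Φ̂(A · μ)`, `M`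
monomial and `v ∈ ℝᵈ`, the quotient being replaced by `0` where `M u = 0`. -/
def deviance (κ : ℝ) (μ : Measure (PathSpace d)) (A : Mat d) : ℝ≥0∞ :=
  ⨆ B ∈ inversion κ (act A μ), ⨅ (M : Mat d) (_ : IsMonomial M) (v : Eucl d),
    ⨆ (u : Eucl d) (_ : u - v ∈ spatialSupport μ),
      open Classical in
      if mv M u = 0 then 0
      else ENNReal.ofReal (‖mv B (mv A (u - v)) - mv M u‖ / ‖mv M u‖)

/-- The radius `δ̃(ε) = c₀ ∧ [c₁² (ε / (c₂ + ε))²]`. -/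
def robustRadius (c : Fin 5 → ℝ) (ε : ℝ) : ℝ :=
  min (c 0) (c 1 ^ 2 * (ε / (c 2 + ε)) ^ 2)

/-- The property of the constants `c₀, …, c₄ > 0` of the robustness theorem at the cause
`(μS, A)`, for perturbations of the source and a fixed linear mixing: for each `ε > 0` and each
`μ` in the `δ`-ball around `μS` of radius `δ̃(ε)`, every `θ ∈ Φ̂(A · μ)` is of the form
`M (1 + E) A⁻¹` with `M` monomial, `‖M‖ ≤ c₃` and `‖E‖ ≤ ε`, and the deviance at `(μ, A)` is at
most `c₄ ε`. -/
structure IsRobustnessConstants (κ : ℝ) (μS : Measure (PathSpace d)) (A : Mat d)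
    (c : Fin 5 → ℝ) : Prop where
  pos : ∀ i, 0 < c i
  factorisation : ∀ ε > 0, ∀ μ : Measure (PathSpace d), IsCoSignal μ →
    premetric μS μ < robustRadius c ε → ∀ θ ∈ inversion κ (act A μ),
      ∃ M : Mat d, IsMonomial M ∧ frobNorm M ≤ c 3 ∧
        ∃ E : Mat d, frobNorm E ≤ ε ∧ θ = M * (1 + E) * A⁻¹
  deviance_le : ∀ ε > 0, ∀ μ : Measure (PathSpace d), IsCoSignal μ →
    premetric μS μ < robustRadius c ε → deviance κ μ A ≤ ENNReal.ofReal (c 4 * ε)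

/-! ### Estimators -/

/-- The estimation error `γ = max_{|w| = 2,3} |⟨μ⟩_w - ⟨μ'⟩_w|`. -/
def momentError (μ μ' : Measure (PathSpace d)) : ℝ :=
  coSupNorm (coredinates μ - coredinates μ')

/-- `m` and `M` are constants for the level `e` in the relation `γ_n = O_P(α_n)`:
`sup_{n ≥ m} ℙ(γ_n ≥ M α_n) ≤ e`. -/
def IsRateConstants {Ω : Type*} [MeasurableSpace Ω] (P : Measure Ω) (γ : ℕ → Ω → ℝ)
    (α : ℕ → ℝ) (e m M : ℝ) : Prop :=
  0 < m ∧ 0 < M ∧ ∀ n : ℕ, m ≤ n → P {ω | M * α n ≤ γ n ω} ≤ ENNReal.ofReal e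

/-- `γ_n = O_P(α_n)` for a strictly decreasing null sequence `α`. -/
def HasRate {Ω : Type*} [MeasurableSpace Ω] (P : Measure Ω) (γ : ℕ → Ω → ℝ)
    (α : ℕ → ℝ) : Prop :=
  StrictAnti α ∧ Tendsto α atTop (𝓝 0) ∧
    ∀ e > 0, ∃ m M : ℝ, IsRateConstants P γ α e m M

open Classical in
/-- The relative error `sup_t |Θ X_t - M S_t| / |M S_t|`, the supremum ranging over those `t` with
`S_t ≠ 0`. -/
def supRelError (Θ M : Mat d) (X S : PathSpace d) : ℝ≥0∞ :=
  ⨆ t : unitInterval, if S t = 0 then 0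
    else ENNReal.ofReal (‖mv Θ (X t) - mv M (S t)‖ / ‖mv M (S t)‖)

/-- With probability at least `q` (on a measurable event of at least that probability), every
`θ ∈ Φ̂(μ̂(ω))` recovers the source `S` from `X` up to a monomial matrix with relative
error at most `ε`. -/
def RecoversWithProb {Ω : Type*} [MeasurableSpace Ω] (P : Measure Ω) (κ : ℝ)
    (X S : Ω → PathSpace d) (est : Ω → Measure (PathSpace d)) (ε q : ℝ) : Prop :=
  ∃ F : Set Ω, MeasurableSet F ∧ ENNReal.ofReal q ≤ P F ∧ ∀ ω ∈ F,
    ∀ θ ∈ inversion κ (est ω), ∃ M : Mat d, IsMonomial M ∧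
      supRelError θ M (X ω) (S ω) ≤ ENNReal.ofReal ε

end SigICA

end

/-! Let `D` be the diagonal matrix of the standard deviations `√⟨S⟩_ii`, let `μ` be close to the
source, and let `G`, `T` be its second and third order moments standardised by `D`. Both lie
entrywise within `δ = δ(S, μ)` of the identity and of a diagonal tensor. Moments transform
multilinearly under linear maps (`sigMoment_act_two`, `sigMoment_act_three`). For a candidate `θ`
with whitening matrix `R` of `A · μ`, everything is therefore governed by `U = θ R A D`. Unit rows
of `θ` make all second order diagonal moments of the candidate equal to `1`, so the normalisation in
the contrast disappears and the statistics are the images of `G` and `T` under `U`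
(`normStat_candidate`).

The contrast has a competitor of size `O(δ²)`, namely the `θ` for which `U` is diagonal. It is
almost orthogonal, so it is admissible as soon as `κ > 1` and `δ` is small (`exists_contrast_le`).
Hence at a minimiser all off-diagonal statistics are `O(δ)`. Contracting the third order ones with
the bounded inverse of `U` shows that `m_a U_ia U_ja = O(δ)` for `i ≠ j`, where `m_a` is the
standardised `⟨S⟩_aaa`. So each column with `m_a ≠ 0` has only one entry that is not small. The at
most one remaining column is handled by the second order statistics, which make the rows of `U`
almost orthogonal (`exists_perm_of_small_statistics`). Thus `U` is a monomial matrix up to `O(δ)`,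
and undoing `D` and `A` gives `θ R = M (1 + E) A⁻¹` with `E = O(δ)`
(`exists_factorisation_of_small_premetric`). This yields (a).

For (b), an estimate of the law of `X` is read as `A · μ` with `μ` its pullback by `A⁻¹`. The
pullback enlarges the moment error by at most `(1 + ‖A⁻¹‖_∞)³` (`coSupNorm_act_sub_le`). The modulus
`ω_φ` is linear with positive slope (`modulus_eq`), so the rate condition puts `μ` in the ball of
(a) with the required probability. -/

noncomputable section

namespace SigICA

variable {d : ℕ}

/-! ### Linear images of paths -/

theorem mv_apply (A : Mat d) (x : Eucl d) (i : Fin d) : mv A x i = ∑ j, A i j * x j := by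
  simp [mv, Matrix.ofLp_toEuclideanCLM, Matrix.mulVec, dotProduct]

theorem mv_mul (A B : Mat d) (x : Eucl d) : mv (A * B) x = mv A (mv B x) := by
  simp [mv, map_mul]

theorem mv_one (x : Eucl d) : mv (1 : Mat d) x = x := by
  simp [mv, map_one]

theorem pathAct_apply (A : Mat d) (x : PathSpace d) (t : unitInterval) :
    pathAct A x t = mv A (x t) := rfl

theorem pathAct_pathAct (A B : Mat d) (x : PathSpace d) :
    pathAct A (pathAct B x) = pathAct (A * B) x := by
  ext1 t
  simp [pathAct_apply, mv_mul]

theorem pathAct_one (x : PathSpace d) : pathAct (1 : Mat d) x = x := by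
  ext1 t
  simp [pathAct_apply, mv_one]

theorem continuous_pathAct (A : Mat d) : Continuous (pathAct A) :=
  ContinuousMap.continuous_postcomp _

theorem measurable_pathAct (A : Mat d) : Measurable (pathAct A) :=
  (continuous_pathAct A).measurable

/-- Integrals and almost sure statements pass through a measurable embedding without any
measurability of the integrand, so measurability of `sig` never has to be discussed. -/
theorem measurableEmbedding_pathAct {A : Mat d} (hA : IsUnit A.det) :
    MeasurableEmbedding (pathAct A) :=
  MeasurableEquiv.measurableEmbedding
    { toFun := pathAct A
      invFun := pathAct A⁻¹
      left_inv := fun x => by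
        rw [pathAct_pathAct, Matrix.nonsing_inv_mul _ hA, pathAct_one]
      right_inv := fun x => by
        rw [pathAct_pathAct, Matrix.mul_nonsing_inv _ hA, pathAct_one]
      measurable_toFun := measurable_pathAct A
      measurable_invFun := measurable_pathAct A⁻¹ }

theorem act_act (A B : Mat d) (μ : Measure (PathSpace d)) : act A (act B μ) = act (A * B) μ := by
  unfold act
  rw [Measure.map_map (measurable_pathAct A) (measurable_pathAct B)]
  congr 1
  funext x
  exact pathAct_pathAct A B x

theorem act_one (μ : Measure (PathSpace d)) : act (1 : Mat d) μ = μ := by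
  unfold act
  rw [show pathAct (1 : Mat d) = id from funext pathAct_one, Measure.map_id]

theorem ext_pathAct (A : Mat d) (x : PathSpace d) (t : ℝ) (i : Fin d) :
    ext (pathAct A x) t i = ∑ a, A i a * ext x t a := by
  simp only [ext, IccExtend, Function.comp]
  rw [pathAct_apply, mv_apply]

/-! ### Iterated integrals of absolutely continuous paths -/

theorem absolutelyContinuousOnInterval_clm_comp {E F : Type*} [NormedAddCommGroup E]
    [NormedSpace ℝ E] [NormedAddCommGroup F] [NormedSpace ℝ F] (L : E →L[ℝ] F) {f : ℝ → E}
    {a b : ℝ} (hf : AbsolutelyContinuousOnInterval f a b) :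
    AbsolutelyContinuousOnInterval (fun t => L (f t)) a b := by
  refine squeeze_zero (fun t => Finset.sum_nonneg fun i _ => dist_nonneg) (fun t => ?_)
    (by simpa using Tendsto.const_mul ‖L‖ hf)
  rw [Finset.mul_sum]
  refine Finset.sum_le_sum fun i _ => ?_
  rw [dist_eq_norm, dist_eq_norm, ← map_sub]
  exact L.le_opNorm _

theorem IsACPath.coord {x : PathSpace d} (hx : IsACPath x) (i : Fin d) :
    AbsolutelyContinuousOnInterval (fun t => ext x t i) 0 1 :=
  absolutelyContinuousOnInterval_clm_comp (EuclideanSpace.proj (𝕜 := ℝ) i) hx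

theorem IsACPath.pathAct {x : PathSpace d} (hx : IsACPath x) (A : Mat d) :
    IsACPath (pathAct A x) :=
  absolutelyContinuousOnInterval_clm_comp (mv A) hx

theorem IsACPath.intervalIntegrable_mul_deriv {x : PathSpace d} (hx : IsACPath x) (i : Fin d)
    {f : ℝ → ℝ} (hf : ContinuousOn f (Icc 0 1)) :
    IntervalIntegrable (fun s => f s * deriv (fun r => ext x r i) s) volume 0 1 :=
  (hx.coord i).intervalIntegrable_deriv.continuousOn_mul (by rwa [uIcc_of_le zero_le_one])

theorem IsACPath.continuousOn_runningIntegral {x : PathSpace d} (hx : IsACPath x)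
    (w : List (Fin d)) : ContinuousOn (runningIntegral x w) (Icc 0 1) := by
  induction w with
  | nil => simpa only [runningIntegral] using continuousOn_const
  | cons i w ih =>
    have h := (hx.intervalIntegrable_mul_deriv i
      ih).absolutelyContinuousOnInterval_intervalIntegral (c := 0) (by simp)
    simpa [runningIntegral, uIcc_of_le] using h.continuousOn

theorem IsACPath.ae_deriv_pathAct {x : PathSpace d} (hx : IsACPath x) (A : Mat d) (i : Fin d) :
    ∀ᵐ s : ℝ, s ∈ Icc (0 : ℝ) 1 → deriv (fun r => ext (SigICA.pathAct A x) r i) s =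
      ∑ a, A i a * deriv (fun r => ext x r a) s := by
  have h : ∀ᵐ s : ℝ, ∀ a : Fin d, s ∈ uIcc (0 : ℝ) 1 →
      DifferentiableAt ℝ (fun t => ext x t a) s :=
    ae_all_iff.2 fun a => (hx.coord a).ae_differentiableAt
  filter_upwards [h] with s hs hs'
  rw [← uIcc_of_le zero_le_one] at hs'
  simp_rw [ext_pathAct]
  rw [deriv_fun_sum fun a _ => (hs a hs').const_mul (A i a)]
  exact Finset.sum_congr rfl fun a _ => deriv_const_mul _ (hs a hs')

/-- The inductive step behind multilinearity of the signature: each further outer differential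
contributes one more sum against a row of `A`, because almost everywhere the derivative of `A x` is
`A` applied to that of `x`. -/
theorem IsACPath.integral_sum_mul_deriv_pathAct {x : PathSpace d} (hx : IsACPath x) (A : Mat d)
    (i : Fin d) {ι : Type*} [Fintype ι] (c : ι → ℝ) {f : ℝ → ℝ} {g : ι → ℝ → ℝ}
    (hg : ∀ k, ContinuousOn (g k) (Icc 0 1)) (hf : ∀ s ∈ Icc (0 : ℝ) 1, f s = ∑ k, c k * g k s)
    {t : ℝ} (ht : t ∈ Icc (0 : ℝ) 1) :
    ∫ s in (0 : ℝ)..t, f s * deriv (fun r => ext (SigICA.pathAct A x) r i) s =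
      ∑ k, ∑ a, c k * A i a * ∫ s in (0 : ℝ)..t, g k s * deriv (fun r => ext x r a) s := by
  have hsub : uIcc 0 t ⊆ uIcc (0 : ℝ) 1 := by
    rw [uIcc_of_le ht.1, uIcc_of_le zero_le_one]
    exact Icc_subset_Icc_right ht.2
  have hint : ∀ k a, IntervalIntegrable (fun s => g k s * deriv (fun r => ext x r a) s)
      volume 0 t := fun k a => (hx.intervalIntegrable_mul_deriv a (hg k)).mono_set hsub
  have hcongr : ∫ s in (0 : ℝ)..t, f s * deriv (fun r => ext (SigICA.pathAct A x) r i) s =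
      ∫ s in (0 : ℝ)..t, ∑ k, ∑ a, c k * A i a * (g k s * deriv (fun r => ext x r a) s) := by
    refine intervalIntegral.integral_congr_ae ?_
    filter_upwards [hx.ae_deriv_pathAct A i] with s hs hs'
    have hs1 : s ∈ Icc (0 : ℝ) 1 := by
      have := hsub (uIoc_subset_uIcc hs')
      rwa [uIcc_of_le zero_le_one] at this
    rw [hs hs1, hf s hs1, Finset.sum_mul_sum]
    exact Finset.sum_congr rfl fun k _ => Finset.sum_congr rfl fun a _ => by ring
  rw [hcongr, intervalIntegral.integral_finsetSum]
  · refine Finset.sum_congr rfl fun k _ => ?_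
    rw [intervalIntegral.integral_finsetSum]
    · exact Finset.sum_congr rfl fun a _ => intervalIntegral.integral_const_mul _ _
    · exact fun a _ => (hint k a).const_mul _
  · intro k _
    have := IntervalIntegrable.sum Finset.univ
      (f := fun a s => c k * A i a * (g k s * deriv (fun r => ext x r a) s))
      (fun a _ => (hint k a).const_mul (c k * A i a))
    rwa [Finset.sum_fn] at this

theorem IsACPath.runningIntegral_pathAct_one {x : PathSpace d} (hx : IsACPath x) (A : Mat d)
    (i : Fin d) {t : ℝ} (ht : t ∈ Icc (0 : ℝ) 1) :
    runningIntegral (SigICA.pathAct A x) [i] t = ∑ a, A i a * runningIntegral x [a] t := by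
  have := hx.integral_sum_mul_deriv_pathAct A i (ι := Unit) (fun _ => 1) (f := fun _ => 1)
    (g := fun _ _ => 1) (fun _ => continuousOn_const) (fun _ _ => by simp) ht
  simpa [runningIntegral] using this

theorem IsACPath.runningIntegral_pathAct_two {x : PathSpace d} (hx : IsACPath x) (A : Mat d)
    (i j : Fin d) {t : ℝ} (ht : t ∈ Icc (0 : ℝ) 1) :
    runningIntegral (SigICA.pathAct A x) [j, i] t =
      ∑ a, ∑ b, A i a * A j b * runningIntegral x [b, a] t :=
  hx.integral_sum_mul_deriv_pathAct A j (fun a => A i a) (g := fun a => runningIntegral x [a])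
    (fun _ => hx.continuousOn_runningIntegral _)
    (fun _ hs => hx.runningIntegral_pathAct_one A i hs) ht

theorem IsACPath.runningIntegral_pathAct_three {x : PathSpace d} (hx : IsACPath x) (A : Mat d)
    (i j k : Fin d) {t : ℝ} (ht : t ∈ Icc (0 : ℝ) 1) :
    runningIntegral (SigICA.pathAct A x) [k, j, i] t =
      ∑ a, ∑ b, ∑ c, A i a * A j b * A k c * runningIntegral x [c, b, a] t := by
  have := hx.integral_sum_mul_deriv_pathAct A k (ι := Fin d × Fin d)
    (fun p => A i p.1 * A j p.2) (f := runningIntegral (SigICA.pathAct A x) [j, i])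
    (g := fun p => runningIntegral x [p.2, p.1])
    (fun _ => hx.continuousOn_runningIntegral _)
    (fun s hs => by
      rw [hx.runningIntegral_pathAct_two A i j hs, Fintype.sum_prod_type]) ht
  rw [Fintype.sum_prod_type] at this
  exact this

theorem IsACPath.sig_pathAct_two {x : PathSpace d} (hx : IsACPath x) (A : Mat d) (i j : Fin d) :
    sig [i, j] (SigICA.pathAct A x) = ∑ a, ∑ b, A i a * A j b * sig [a, b] x :=
  hx.runningIntegral_pathAct_two A i j (by simp)

theorem IsACPath.sig_pathAct_three {x : PathSpace d} (hx : IsACPath x) (A : Mat d)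
    (i j k : Fin d) : sig [i, j, k] (SigICA.pathAct A x) =
      ∑ a, ∑ b, ∑ c, A i a * A j b * A k c * sig [a, b, c] x :=
  hx.runningIntegral_pathAct_three A i j k (by simp)

/-- Integration by parts gives `sig_ii(x) = (xⁱ_1 - xⁱ_0)² / 2`. Nonvanishing diagonal moments are
therefore positive, and their square roots are meaningful weights. -/
theorem IsACPath.sig_self_nonneg {x : PathSpace d} (hx : IsACPath x) (i : Fin d) :
    0 ≤ sig [i, i] x := by
  have hrun : ∀ s ∈ Icc (0 : ℝ) 1, runningIntegral x [i] s = ext x s i - ext x 0 i := by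
    intro s hs
    have hsub : uIcc 0 s ⊆ uIcc (0 : ℝ) 1 := by
      rw [uIcc_of_le hs.1, uIcc_of_le zero_le_one]
      exact Icc_subset_Icc_right hs.2
    simpa [runningIntegral] using ((hx.coord i).mono hsub).integral_deriv_eq_sub
  set f : ℝ → ℝ := fun s => ext x s i - ext x 0 i with hf
  have hderiv : ∀ s, deriv f s = deriv (fun r => ext x r i) s := fun s => deriv_sub_const _
  have hac : AbsolutelyContinuousOnInterval f 0 1 :=
    (hx.coord i).sub (LipschitzWith.const (ext x 0 i)).lipschitzOnWith.absolutelyContinuousOnInterval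
  have hsig : sig [i, i] x = ∫ s in (0 : ℝ)..1, f s * deriv f s := by
    simp only [sig, List.reverse_cons, List.reverse_nil, List.nil_append, List.cons_append]
    rw [runningIntegral]
    refine intervalIntegral.integral_congr fun s hs => ?_
    rw [uIcc_of_le zero_le_one] at hs
    rw [hrun s hs, hderiv]
  have hparts := hac.integral_mul_deriv_eq_deriv_mul hac
  have hcomm : ∫ s in (0 : ℝ)..1, deriv f s * f s = ∫ s in (0 : ℝ)..1, f s * deriv f s :=
    intervalIntegral.integral_congr fun s _ => mul_comm _ _
  rw [hcomm] at hparts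
  have hzero : f 0 = 0 := sub_self _
  rw [hsig]
  nlinarith [mul_self_nonneg (f 1)]

/-! ### Signature moments of linear images -/

/-- Signals whose signature moments of orders two and three exist. -/
def HasMoments (μ : Measure (PathSpace d)) : Prop :=
  IsSignal μ ∧ ∀ w : List (Fin d), w.length = 2 ∨ w.length = 3 → Integrable (sig w) μ

theorem IsCoSignal.hasMoments {μ : Measure (PathSpace d)} (h : IsCoSignal μ) : HasMoments μ :=
  ⟨h.1, h.2.1⟩

namespace HasMoments

variable {μ : Measure (PathSpace d)}

theorem ae_isACPath (h : HasMoments μ) : ∀ᵐ x ∂μ, IsACPath x := h.1.2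

theorem integrable_two (h : HasMoments μ) (i j : Fin d) : Integrable (sig [i, j]) μ :=
  h.2 _ (Or.inl rfl)

theorem integrable_three (h : HasMoments μ) (i j k : Fin d) : Integrable (sig [i, j, k]) μ :=
  h.2 _ (Or.inr rfl)

theorem integrable_sig_pathAct_two (h : HasMoments μ) (A : Mat d) (i j : Fin d) :
    Integrable (fun x => sig [i, j] (pathAct A x)) μ := by
  refine (integrable_congr (h.ae_isACPath.mono fun x hx => hx.sig_pathAct_two A i j)).2 ?_
  exact integrable_finsetSum _ fun a _ => integrable_finsetSum _ fun b _ =>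
    (h.integrable_two a b).const_mul _

theorem integrable_sig_pathAct_three (h : HasMoments μ) (A : Mat d) (i j k : Fin d) :
    Integrable (fun x => sig [i, j, k] (pathAct A x)) μ := by
  refine (integrable_congr (h.ae_isACPath.mono fun x hx => hx.sig_pathAct_three A i j k)).2 ?_
  exact integrable_finsetSum _ fun a _ => integrable_finsetSum _ fun b _ =>
    integrable_finsetSum _ fun c _ => (h.integrable_three a b c).const_mul _

theorem sigMoment_act_two (h : HasMoments μ) {A : Mat d} (hA : IsUnit A.det) (i j : Fin d) :
    sigMoment (act A μ) [i, j] = ∑ a, ∑ b, A i a * A j b * sigMoment μ [a, b] := by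
  unfold sigMoment act
  rw [(measurableEmbedding_pathAct hA).integral_map,
    integral_congr_ae (h.ae_isACPath.mono fun x hx => hx.sig_pathAct_two A i j),
    integral_finsetSum _ fun a _ => integrable_finsetSum _ fun b _ =>
      (h.integrable_two a b).const_mul _]
  refine Finset.sum_congr rfl fun a _ => ?_
  rw [integral_finsetSum _ fun b _ => (h.integrable_two a b).const_mul _]
  exact Finset.sum_congr rfl fun b _ => integral_const_mul _ _

theorem sigMoment_act_three (h : HasMoments μ) {A : Mat d} (hA : IsUnit A.det)
    (i j k : Fin d) : sigMoment (act A μ) [i, j, k] =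
      ∑ a, ∑ b, ∑ c, A i a * A j b * A k c * sigMoment μ [a, b, c] := by
  unfold sigMoment act
  rw [(measurableEmbedding_pathAct hA).integral_map,
    integral_congr_ae (h.ae_isACPath.mono fun x hx => hx.sig_pathAct_three A i j k),
    integral_finsetSum _ fun a _ => integrable_finsetSum _ fun b _ =>
      integrable_finsetSum _ fun c _ => (h.integrable_three a b c).const_mul _]
  refine Finset.sum_congr rfl fun a _ => ?_
  rw [integral_finsetSum _ fun b _ => integrable_finsetSum _ fun c _ =>
    (h.integrable_three a b c).const_mul _]
  refine Finset.sum_congr rfl fun b _ => ?_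
  rw [integral_finsetSum _ fun c _ => (h.integrable_three a b c).const_mul _]
  exact Finset.sum_congr rfl fun c _ => integral_const_mul _ _

theorem act (h : HasMoments μ) {A : Mat d} (hA : IsUnit A.det) : HasMoments (act A μ) := by
  have := h.1.1
  have hemb := measurableEmbedding_pathAct hA
  refine ⟨⟨Measure.isProbabilityMeasure_map (measurable_pathAct A).aemeasurable, ?_⟩, ?_⟩
  · exact hemb.ae_map_iff.2 (h.ae_isACPath.mono fun x hx => hx.pathAct A)
  · intro w hw
    refine hemb.integrable_map_iff.2 ?_
    match w, hw with
    | [i, j], _ => exact h.integrable_sig_pathAct_two A i j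
    | [i, j, k], _ => exact h.integrable_sig_pathAct_three A i j k
    | [], hw => simp at hw
    | [_], hw => simp at hw
    | _ :: _ :: _ :: _ :: w, hw => simp at hw

theorem diagMoment_nonneg (h : HasMoments μ) (i : Fin d) : 0 ≤ diagMoment μ i :=
  integral_nonneg_of_ae (h.ae_isACPath.mono fun _ hx => hx.sig_self_nonneg i)

end HasMoments

theorem IsCoSignal.diagMoment_pos {μ : Measure (PathSpace d)} (h : IsCoSignal μ) (i : Fin d) :
    0 < diagMoment μ i :=
  lt_of_le_of_ne (h.hasMoments.diagMoment_nonneg i) (Ne.symm (h.2.2 i))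

/-! ### Approximate permutation patterns -/

theorem abs_sum_le_card_mul {f : Fin d → ℝ} {b : ℝ} (h : ∀ i, |f i| ≤ b) :
    |∑ i, f i| ≤ d * b := by
  refine (Finset.abs_sum_le_sum_abs _ _).trans ?_
  refine (Finset.sum_le_card_nsmul _ _ _ fun i _ => h i).trans ?_
  simp

theorem abs_mul_le_mul {a b p q : ℝ} (ha : |a| ≤ p) (hb : |b| ≤ q) : |a * b| ≤ p * q := by
  rw [abs_mul]
  exact mul_le_mul ha hb (abs_nonneg _) ((abs_nonneg _).trans ha)

theorem abs_matrix_mul_apply_le {A B : Mat d} {p q : ℝ} (hA : ∀ i j, |A i j| ≤ p)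
    (hB : ∀ i j, |B i j| ≤ q) (i j : Fin d) : |(A * B) i j| ≤ d * (p * q) := by
  rw [Matrix.mul_apply]
  exact abs_sum_le_card_mul (fun k => abs_mul_le_mul (hA i k) (hB k j))

/-- A well-conditioned matrix, all of whose columns but one have at most one entry that is not
small, and whose rows are almost orthogonal, is close to a monomial matrix. -/
theorem exists_perm_of_abs_mul_le [NeZero d] {U V : Mat d} {L e : ℝ} (hL : 1 ≤ L) (he : 0 ≤ e)
    (hU : ∀ i a, |U i a| ≤ L) (hV : ∀ a i, |V a i| ≤ L) (hVU : V * U = 1) (c : Fin d)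
    (hcol : ∀ a, a ≠ c → ∀ i j, i ≠ j → |U i a * U j a| ≤ e)
    (hrow : ∀ i j, i ≠ j → |∑ a, U i a * U j a| ≤ e)
    (hsmall : 4 * (d : ℝ) ^ 3 * L ^ 4 * e ≤ 1) :
    ∃ τ : Equiv.Perm (Fin d), ∀ a, 1 / (2 * d * L) ≤ |U (τ a) a| ∧
      ∀ j, j ≠ τ a → |U j a| ≤ 4 * d * L * e := by
  have hn : (1 : ℝ) ≤ d := by exact_mod_cast NeZero.one_le
  have hL0 : 0 < L := by linarith
  have hn0 : (0 : ℝ) < d := by linarith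
  have hUV : U * V = 1 := mul_eq_one_comm.1 hVU
  have hentry : ∀ a b, ∑ i, V a i * U i b = if a = b then 1 else 0 := fun a b => by
    rw [← Matrix.mul_apply, hVU, Matrix.one_apply]
  -- every column has an entry that is bounded below
  have hbig : ∀ a, ∃ i, 1 / (d * L) ≤ |U i a| := by
    intro a
    by_contra! hcon
    have h1 := hentry a a
    rw [if_pos rfl] at h1
    have h2 : |∑ i, V a i * U i a| < ∑ _i : Fin d, L * (1 / (d * L)) := by
      refine (Finset.abs_sum_le_sum_abs _ _).trans_lt ?_
      refine Finset.sum_lt_sum_of_nonempty ⟨0, Finset.mem_univ _⟩ fun i _ => ?_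
      rw [abs_mul]
      calc |V a i| * |U i a| ≤ L * |U i a| := mul_le_mul_of_nonneg_right (hV a i) (abs_nonneg _)
        _ < L * (1 / (d * L)) := mul_lt_mul_of_pos_left (hcon i) hL0
    rw [h1, abs_one, Finset.sum_const, Finset.card_univ, Fintype.card_fin, nsmul_eq_mul] at h2
    have h3 : (d : ℝ) * (L * (1 / (d * L))) = 1 := by field_simp
    linarith
  choose f hf using hbig
  -- The product with the dominant entry of the column is at most `e`, and the dominant entry is at
  -- least `1 / (d L)`.
  have hother : ∀ a, a ≠ c → ∀ j, j ≠ f a → |U j a| ≤ d * L * e := by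
    intro a ha j hj
    have h1 := hcol a ha j (f a) hj
    rw [abs_mul] at h1
    have h2 : |U j a| * (1 / (d * L)) ≤ e :=
      (mul_le_mul_of_nonneg_left (hf a) (abs_nonneg _)).trans h1
    rw [mul_one_div, div_le_iff₀ (by positivity)] at h2
    linarith
  have hpow : (d : ℝ) ^ 2 * L ^ 2 * e ≤ 1 / 4 := by
    have : (d : ℝ) ^ 2 * L ^ 2 ≤ d ^ 3 * L ^ 4 := by gcongr <;> first | assumption | norm_num
    nlinarith [mul_le_mul_of_nonneg_right this he]
  -- If columns `a ≠ b` shared their dominant row, then `(VU)_ab = 0` would force `V a (f b)` to be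
  -- small, whereas `(VU)_aa = 1` keeps `V a (f a) * U (f a) a` away from `0`.
  have hinj : Set.InjOn f ((Finset.univ.erase c : Finset (Fin d)) : Set (Fin d)) := by
    intro a ha b hb hab
    by_contra hne
    have ha' : a ≠ c := by simpa using ha
    have hb' : b ≠ c := by simpa using hb
    have h0 := hentry a b
    rw [if_neg hne, ← Finset.add_sum_erase _ _ (Finset.mem_univ (f b))] at h0
    have h1 := hentry a a
    rw [if_pos rfl, ← Finset.add_sum_erase _ _ (Finset.mem_univ (f a))] at h1
    have hrest : ∀ b', b' ≠ c → |∑ x ∈ Finset.univ.erase (f b'), V a x * U x b'| ≤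
        d * (L * (d * L * e)) := by
      intro b' hb'
      refine (Finset.abs_sum_le_sum_abs _ _).trans ?_
      refine (Finset.sum_le_card_nsmul _ _ (L * (d * L * e)) fun x hx => ?_).trans ?_
      · exact abs_mul_le_mul (hV a x) (hother b' hb' x (Finset.ne_of_mem_erase hx))
      · rw [nsmul_eq_mul]
        have : ((Finset.univ.erase (f b')).card : ℝ) ≤ d := by
          exact_mod_cast (Finset.card_erase_le).trans (by simp)
        exact mul_le_mul_of_nonneg_right this (by positivity)
    have h2 : |V a (f b)| * (1 / (d * L)) ≤ d * (L * (d * L * e)) := by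
      calc |V a (f b)| * (1 / (d * L)) ≤ |V a (f b)| * |U (f b) b| :=
            mul_le_mul_of_nonneg_left (hf b) (abs_nonneg _)
        _ = |∑ x ∈ Finset.univ.erase (f b), V a x * U x b| := by
            rw [← abs_mul, eq_neg_of_add_eq_zero_left h0, abs_neg]
        _ ≤ _ := hrest b hb'
    rw [mul_one_div, div_le_iff₀ (by positivity)] at h2
    have h3 : |V a (f a) * U (f a) a| ≤ d * (L * (d * L * e)) * (d * L) * L :=
      abs_mul_le_mul (by rw [hab]; exact h2) (hU _ _)
    have h4 := abs_add_le (V a (f a) * U (f a) a)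
      (∑ x ∈ Finset.univ.erase (f a), V a x * U x a)
    rw [h1, abs_one] at h4
    have h5 := hrest a ha'
    nlinarith
  -- Extending `f` from the columns other than `c` to a permutation assigns to `c` the one row that
  -- is left, whatever `f c` was.
  obtain ⟨τ', hτ'⟩ := Finset.exists_equiv_extend_of_card_eq (t := (Finset.univ : Finset (Fin d)))
    (by simp) (Finset.subset_univ _) hinj
  let τ : Equiv.Perm (Fin d) := τ'.trans (Equiv.subtypeUnivEquiv fun x => Finset.mem_univ x)
  have hτ : ∀ a, a ≠ c → τ a = f a := fun a ha => hτ' a (by simpa using ha)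
  have hsmallcol : ∀ a, a ≠ c → ∀ j, j ≠ τ a → |U j a| ≤ d * L * e := fun a ha j hj =>
    hother a ha j (by rwa [← hτ a ha])
  -- The row `τ c` is dominant for no other column, so its remaining entries are small and the
  -- diagonal entry `1` of `U V` must come from column `c`.
  have hlast : 1 / (2 * L) ≤ |U (τ c) c| := by
    have h1 : ∑ a, U (τ c) a * V a (τ c) = 1 := by
      rw [← Matrix.mul_apply, hUV, Matrix.one_apply_eq]
    rw [← Finset.add_sum_erase _ _ (Finset.mem_univ c)] at h1
    have h2 : |∑ a ∈ Finset.univ.erase c, U (τ c) a * V a (τ c)| ≤ d * (d * L * e * L) := by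
      refine (Finset.abs_sum_le_sum_abs _ _).trans ?_
      refine (Finset.sum_le_card_nsmul _ _ (d * L * e * L) fun a ha => ?_).trans ?_
      · have ha' := Finset.ne_of_mem_erase ha
        exact abs_mul_le_mul (hsmallcol a ha' _ fun h => ha' (τ.injective h).symm) (hV _ _)
      · rw [nsmul_eq_mul]
        have : ((Finset.univ.erase c).card : ℝ) ≤ d := by
          exact_mod_cast (Finset.card_erase_le).trans (by simp)
        exact mul_le_mul_of_nonneg_right this (by positivity)
    have h3 := abs_add_le (U (τ c) c * V c (τ c))
      (∑ a ∈ Finset.univ.erase c, U (τ c) a * V a (τ c))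
    rw [h1, abs_one, abs_mul] at h3
    have h4 : |U (τ c) c| * |V c (τ c)| ≤ |U (τ c) c| * L :=
      mul_le_mul_of_nonneg_left (hV _ _) (abs_nonneg _)
    rw [div_le_iff₀ (by positivity)]
    nlinarith
  refine ⟨τ, fun a => ?_⟩
  by_cases ha : a = c
  · subst ha
    refine ⟨le_trans ?_ hlast, fun j hj => ?_⟩
    · exact one_div_le_one_div_of_le (by positivity) (by nlinarith)
    -- In the exceptional column, near-orthogonality of rows replaces the column bound: all other
    -- summands of the inner product of rows `τ a` and `j` are at most `e`.
    · have h1 := hrow (τ a) j hj.symm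
      rw [← Finset.add_sum_erase _ _ (Finset.mem_univ a)] at h1
      have h2 : |∑ b ∈ Finset.univ.erase a, U (τ a) b * U j b| ≤ d * e := by
        refine (Finset.abs_sum_le_sum_abs _ _).trans ?_
        refine (Finset.sum_le_card_nsmul _ _ e fun b hb => ?_).trans ?_
        · exact hcol b (Finset.ne_of_mem_erase hb) _ _ hj.symm
        · rw [nsmul_eq_mul]
          have : ((Finset.univ.erase a).card : ℝ) ≤ d := by
            exact_mod_cast (Finset.card_erase_le).trans (by simp)
          exact mul_le_mul_of_nonneg_right this he
      have h3 : |U (τ a) a * U j a| ≤ e + d * e := by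
        rw [abs_le] at h1 h2 ⊢
        constructor <;> linarith [h1.1, h1.2, h2.1, h2.2]
      rw [abs_mul] at h3
      have h4 : 1 / (2 * L) * |U j a| ≤ e + d * e :=
        (mul_le_mul_of_nonneg_right hlast (abs_nonneg _)).trans h3
      rw [one_div_mul_eq_div, div_le_iff₀ (by positivity)] at h4
      nlinarith [mul_nonneg he hL0.le]
  · refine ⟨?_, fun j hj => ?_⟩
    · rw [hτ a ha]
      exact le_trans (one_div_le_one_div_of_le (by positivity) (by nlinarith)) (hf a)
    · exact (hsmallcol a ha j hj).trans (by nlinarith [mul_nonneg (mul_nonneg hn0.le hL0.le) he])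

/-- The diagonal tensor of order three. -/
def diagTensor (m : Fin d → ℝ) (a b c : Fin d) : ℝ := if a = b ∧ b = c then m a else 0

theorem sum_mul_diagTensor (U : Mat d) (m : Fin d → ℝ) (i j k : Fin d) :
    ∑ a, ∑ b, ∑ c, U i a * U j b * U k c * diagTensor m a b c =
      ∑ a, m a * U i a * U j a * U k a := by
  refine Finset.sum_congr rfl fun a _ => ?_
  rw [Finset.sum_eq_single a, Finset.sum_eq_single a]
  · simp [diagTensor]; ring
  · intro c _ hc
    simp [diagTensor, hc.symm]
  · simp
  · intro b _ hb
    simp [diagTensor, hb.symm]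
  · simp

/-- The image of an almost diagonal tensor having small off-diagonal slices, the products of two
entries of the same column of the transformation are small. -/
theorem abs_mul_mul_le_of_almost_diagTensor {U V : Mat d} {L e δ : ℝ}
    (hU : ∀ i a, |U i a| ≤ L) (hV : ∀ a i, |V a i| ≤ L) (hVU : V * U = 1)
    {m : Fin d → ℝ} {T : Fin d → Fin d → Fin d → ℝ}
    (hT : ∀ a b c, |T a b c - diagTensor m a b c| ≤ δ) {i j : Fin d}
    (h : ∀ k, |∑ a, ∑ b, ∑ c, U i a * U j b * U k c * T a b c| ≤ e) (a : Fin d) :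
    |m a * (U i a * U j a)| ≤ d * (L * (e + d ^ 3 * L ^ 3 * δ)) := by
  have h1 : ∀ k, |∑ a, m a * U i a * U j a * U k a| ≤ e + d ^ 3 * L ^ 3 * δ := by
    intro k
    have h2 : |∑ a, ∑ b, ∑ c, U i a * U j b * U k c * (T a b c - diagTensor m a b c)| ≤
        d * (d * (d * (L * L * L * δ))) := abs_sum_le_card_mul fun a =>
        abs_sum_le_card_mul fun b =>
          abs_sum_le_card_mul fun c =>
            abs_mul_le_mul (abs_mul_le_mul (abs_mul_le_mul (hU i a) (hU j b)) (hU k c)) (hT a b c)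
    have h3 : ∑ a, ∑ b, ∑ c, U i a * U j b * U k c * (T a b c - diagTensor m a b c) =
        (∑ a, ∑ b, ∑ c, U i a * U j b * U k c * T a b c) -
          ∑ a, m a * U i a * U j a * U k a := by
      rw [← sum_mul_diagTensor]
      simp only [mul_sub, Finset.sum_sub_distrib]
    rw [h3] at h2
    have h4 := h k
    rw [abs_le] at h2 h4 ⊢
    constructor <;> nlinarith [h2.1, h2.2, h4.1, h4.2]
  -- Contracting the third slot with row `a` of the inverse isolates column `a`.
  have h5 : m a * (U i a * U j a) = ∑ k, V a k * ∑ b, m b * U i b * U j b * U k b := by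
    have : ∀ k, V a k * ∑ b, m b * U i b * U j b * U k b =
        ∑ b, m b * U i b * U j b * (V a k * U k b) := fun k => by
      rw [Finset.mul_sum]
      exact Finset.sum_congr rfl fun b _ => by ring
    simp_rw [this]
    rw [Finset.sum_comm]
    simp_rw [← Finset.mul_sum, ← Matrix.mul_apply, hVU, Matrix.one_apply]
    simp [mul_assoc]
  rw [h5]
  exact abs_sum_le_card_mul (fun k => abs_mul_le_mul (hV a k) (h1 k))

/-- Quantitative identifiability of a monomial matrix from the off-diagonal statistics of second
and third order. -/
theorem exists_perm_of_small_statistics [NeZero d] {L m₀ : ℝ} (hL : 1 ≤ L) (hm₀ : 0 < m₀)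
    {C : ℝ} (hC : 0 ≤ C) :
    ∃ δ₀ > 0, ∃ K > 0, ∀ δ, 0 ≤ δ → δ < δ₀ → ∀ (U V G : Mat d) (m : Fin d → ℝ)
      (T : Fin d → Fin d → Fin d → ℝ) (c : Fin d),
      (∀ i a, |U i a| ≤ L) → (∀ a i, |V a i| ≤ L) → V * U = 1 → (∀ a, a ≠ c → m₀ ≤ |m a|) →
      (∀ a b, |G a b - (1 : Mat d) a b| ≤ δ) → (∀ a b c, |T a b c - diagTensor m a b c| ≤ δ) →
      (∀ i j, i ≠ j → |∑ a, ∑ b, U i a * U j b * G a b| ≤ C * δ) →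
      (∀ i j k, i ≠ j → |∑ a, ∑ b, ∑ c, U i a * U j b * U k c * T a b c| ≤ C * δ) →
      ∃ τ : Equiv.Perm (Fin d), ∀ a, 1 / (2 * d * L) ≤ |U (τ a) a| ∧
        ∀ j, j ≠ τ a → |U j a| ≤ K * δ := by
  have hn : (1 : ℝ) ≤ d := by exact_mod_cast NeZero.one_le
  have hL0 : 0 < L := by linarith
  have hn0 : (0 : ℝ) < d := by linarith
  -- One constant for both inputs of `exists_perm_of_abs_mul_le`: the summand `1 / m₀` serves the
  -- column products, after division by `m a`, and the summand `1` the inner products of rows.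
  set C' : ℝ := d * (L * (C + d ^ 3 * L ^ 3)) * (1 + 1 / m₀) with hC'
  have hC'pos : 0 < C' := by positivity
  refine ⟨1 / (4 * d ^ 3 * L ^ 4 * C'), by positivity, 4 * d * L * C', by positivity, ?_⟩
  intro δ hδ hδ₀ U V G m T c hU hV hVU hm hG hT h2 h3
  have hUV : U * V = 1 := mul_eq_one_comm.1 hVU
  rw [lt_div_iff₀ (by positivity)] at hδ₀
  have hbase : d * (L * (C * δ + d ^ 3 * L ^ 3 * δ)) ≤ C' * δ := by
    have : (0 : ℝ) ≤ d * (L * (C + d ^ 3 * L ^ 3)) * (1 / m₀) * δ := by positivity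
    rw [hC']
    nlinarith
  have hcol : ∀ a, a ≠ c → ∀ i j, i ≠ j → |U i a * U j a| ≤ C' * δ := by
    intro a ha i j hij
    have h := abs_mul_mul_le_of_almost_diagTensor hU hV hVU hT (fun k => h3 i j k hij) a
    rw [abs_mul] at h
    have h' : m₀ * |U i a * U j a| ≤ d * (L * (C * δ + d ^ 3 * L ^ 3 * δ)) :=
      (mul_le_mul_of_nonneg_right (hm a ha) (abs_nonneg _)).trans h
    rw [← le_div_iff₀' hm₀] at h'
    refine h'.trans ?_
    have : (0 : ℝ) ≤ d * (L * (C + d ^ 3 * L ^ 3)) * δ := by positivity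
    rw [hC', div_eq_mul_one_div]
    nlinarith
  have hrow : ∀ i j, i ≠ j → |∑ a, U i a * U j a| ≤ C' * δ := by
    intro i j hij
    have h4 : |∑ a, ∑ b, U i a * U j b * (G a b - (1 : Mat d) a b)| ≤ d * (d * (L * L * δ)) :=
      abs_sum_le_card_mul fun a =>
        abs_sum_le_card_mul fun b =>
          abs_mul_le_mul (abs_mul_le_mul (hU i a) (hU j b)) (hG a b)
    have h5 : ∑ a, ∑ b, U i a * U j b * (G a b - (1 : Mat d) a b) =
        (∑ a, ∑ b, U i a * U j b * G a b) - ∑ a, U i a * U j a := by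
      simp only [mul_sub, Finset.sum_sub_distrib]
      simp [Matrix.one_apply]
    rw [h5] at h4
    have h6 := h2 i j hij
    have h7 : C * δ + d * (d * (L * L * δ)) ≤ d * (L * (C * δ + d ^ 3 * L ^ 3 * δ)) := by
      have hdL : 1 ≤ d * L := one_le_mul_of_one_le_of_one_le hn hL
      have hdL2 : 1 ≤ (d * L) ^ 2 := one_le_pow₀ hdL
      have e1 : C * δ ≤ d * L * (C * δ) := le_mul_of_one_le_left (by positivity) hdL
      have e2 : d * (d * (L * L * δ)) ≤ (d * L) ^ 2 * (d * (d * (L * L * δ))) :=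
        le_mul_of_one_le_left (by positivity) hdL2
      nlinarith
    rw [abs_le] at h4 h6 ⊢
    constructor <;> linarith [h4.1, h4.2, h6.1, h6.2]
  obtain ⟨τ, hτ⟩ := exists_perm_of_abs_mul_le hL (by positivity) hU hV hVU c hcol hrow
    (by nlinarith)
  refine ⟨τ, fun a => ⟨(hτ a).1, fun j hj => ((hτ a).2 j hj).trans (by nlinarith)⟩⟩

/-! ### Norms and conditioning -/

theorem sq_le_frobNorm_sq (B : Mat d) (i j : Fin d) : B i j ^ 2 ≤ frobNorm B ^ 2 := by
  rw [frobNorm, Real.sq_sqrt (by positivity)]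
  exact (Finset.single_le_sum (f := fun j => B i j ^ 2) (fun _ _ => sq_nonneg _)
    (Finset.mem_univ j)).trans (Finset.single_le_sum (f := fun i => ∑ j, B i j ^ 2)
      (fun _ _ => Finset.sum_nonneg fun _ _ => sq_nonneg _) (Finset.mem_univ i))

theorem frobNorm_nonneg (B : Mat d) : 0 ≤ frobNorm B := Real.sqrt_nonneg _

theorem frobNorm_sq_le {B : Mat d} {b : ℝ} (h : ∀ i j, |B i j| ≤ b) :
    frobNorm B ^ 2 ≤ (d * b) ^ 2 := by
  rw [frobNorm, Real.sq_sqrt (by positivity)]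
  have h1 : ∀ i, |∑ j, B i j ^ 2| ≤ d * b ^ 2 := fun i => abs_sum_le_card_mul fun j => by
    rw [abs_of_nonneg (sq_nonneg _)]
    exact sq_le_sq.2 ((h i j).trans (le_abs_self b))
  refine (le_abs_self _).trans ((abs_sum_le_card_mul h1).trans (le_of_eq (by ring)))

theorem frobNorm_le {B : Mat d} {b : ℝ} (hb : 0 ≤ b) (h : ∀ i j, |B i j| ≤ b) :
    frobNorm B ≤ d * b :=
  le_of_sq_le_sq (frobNorm_sq_le h) (by positivity)

theorem norm_sq_eq_sum (x : Eucl d) : ‖x‖ ^ 2 = ∑ i, x i ^ 2 := by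
  rw [EuclideanSpace.norm_sq_eq]
  simp

theorem norm_mv_le_frobNorm (B : Mat d) (x : Eucl d) : ‖mv B x‖ ≤ frobNorm B * ‖x‖ := by
  refine le_of_sq_le_sq ?_ (mul_nonneg (frobNorm_nonneg B) (norm_nonneg x))
  rw [mul_pow, norm_sq_eq_sum, norm_sq_eq_sum, frobNorm, Real.sq_sqrt (by positivity),
    Finset.sum_mul]
  refine Finset.sum_le_sum fun i _ => ?_
  rw [mv_apply]
  exact Finset.sum_mul_sq_le_sq_mul_sq _ _ _

theorem norm_mv_transpose (B : Mat d) : ‖mv B.transpose‖ = ‖mv B‖ := by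
  have h : mv B.transpose = star (mv B) := by
    unfold mv
    rw [← map_star, Matrix.star_eq_conjTranspose, Matrix.conjTranspose_eq_transpose_of_trivial]
  rw [h]
  exact LinearIsometryEquiv.norm_map ContinuousLinearMap.adjoint (mv B)

theorem mv_single (B : Mat d) (i j : Fin d) : mv B (EuclideanSpace.single j 1) i = B i j := by
  rw [mv_apply]
  simp

theorem norm_mv_single_le (B : Mat d) (j : Fin d) :
    ‖mv B (EuclideanSpace.single j 1)‖ ≤ ‖mv B‖ := by
  simpa using (mv B).le_opNorm (EuclideanSpace.single j 1)

theorem abs_apply_le_norm_mv (B : Mat d) (i j : Fin d) : |B i j| ≤ ‖mv B‖ := by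
  rw [← mv_single B i j, ← Real.norm_eq_abs]
  exact (PiLp.norm_apply_le _ i).trans (norm_mv_single_le B j)

theorem one_le_norm_mv_of_unit_rows [NeZero d] {θ : Mat d} (h : ∀ i, ∑ j, θ i j ^ 2 = 1) :
    1 ≤ ‖mv θ‖ := by
  rw [← norm_mv_transpose]
  refine le_trans (le_of_eq ?_) (norm_mv_single_le θ.transpose 0)
  rw [← sq_eq_sq₀ zero_le_one (norm_nonneg _), norm_sq_eq_sum]
  simp_rw [mv_single, Matrix.transpose_apply]
  rw [h 0, one_pow]

theorem one_le_cond2 [NeZero d] {B : Mat d} (hB : IsUnit B.det) : 1 ≤ cond2 B := by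
  unfold cond2
  have h1 : mv B ∘L mv B⁻¹ = ContinuousLinearMap.id ℝ (Eucl d) := by
    ext1 x
    rw [ContinuousLinearMap.comp_apply, ← mv_mul, Matrix.mul_nonsing_inv _ hB, mv_one]
    rfl
  have h2 := (mv B).opNorm_comp_le (mv B⁻¹)
  rwa [h1, ContinuousLinearMap.norm_id] at h2

theorem sum_sum_mul_mul_one (u : Fin d → ℝ) :
    ∑ a, ∑ b, u a * u b * (1 : Mat d) a b = ∑ a, u a ^ 2 := by
  simp [Matrix.one_apply, sq]

/-- The entrywise error contributes at most `δ (∑ |u_a|)²`, and Cauchy–Schwarz turns this into `d δ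
∑ u_a²`. -/
theorem abs_quadratic_sub_le {G : Mat d} {δ : ℝ} (hδ : 0 ≤ δ)
    (hG : ∀ a b, |G a b - (1 : Mat d) a b| ≤ δ) (u : Fin d → ℝ) :
    |(∑ a, ∑ b, u a * u b * G a b) - ∑ a, u a ^ 2| ≤ d * δ * ∑ a, u a ^ 2 := by
  rw [← sum_sum_mul_mul_one u, ← Finset.sum_sub_distrib]
  simp_rw [← Finset.sum_sub_distrib, ← mul_sub]
  have h1 : ∀ a, |∑ b, u a * u b * (G a b - (1 : Mat d) a b)| ≤ ∑ b, |u a| * |u b| * δ := fun a =>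
    (Finset.abs_sum_le_sum_abs _ _).trans (Finset.sum_le_sum fun b _ => by
      rw [abs_mul, abs_mul]
      exact mul_le_mul_of_nonneg_left (hG a b) (by positivity))
  refine (Finset.abs_sum_le_sum_abs _ _).trans ((Finset.sum_le_sum fun a _ => h1 a).trans ?_)
  have h2 : ∑ a, ∑ b, |u a| * |u b| * δ = (∑ a, |u a|) ^ 2 * δ := by
    rw [sq, Finset.sum_mul_sum]
    simp_rw [Finset.sum_mul]
  have h3 : (∑ a, |u a|) ^ 2 ≤ d * ∑ a, u a ^ 2 := by
    simpa using sq_sum_le_card_mul_sum_sq (s := Finset.univ) (f := fun a => |u a|)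
  rw [h2, sum_sum_mul_mul_one]
  nlinarith

theorem norm_mv_transpose_sq (θ : Mat d) (x : Eucl d) :
    ‖mv θ.transpose x‖ ^ 2 = ∑ a, ∑ b, x a * x b * (θ * θ.transpose) a b := by
  rw [norm_sq_eq_sum]
  simp_rw [mv_apply, Matrix.mul_apply, Matrix.transpose_apply, sq, Finset.sum_mul_sum,
    Finset.mul_sum]
  rw [Finset.sum_comm]
  refine Finset.sum_congr rfl fun a _ => ?_
  rw [Finset.sum_comm]
  exact Finset.sum_congr rfl fun b _ => Finset.sum_congr rfl fun k _ => by ring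

/-- The squared singular values of `θ` lie within `d h` of `1`. The lemma makes the competitor in
the minimisation admissible. -/
theorem cond2_le_of_almost_orthogonal {θ : Mat d} (hθ : IsUnit θ.det) {h : ℝ} (h0 : 0 ≤ h)
    (hh : d * h ≤ 1 / 2) (hent : ∀ a b, |(θ * θ.transpose) a b - (1 : Mat d) a b| ≤ h) :
    cond2 θ ≤ 1 + 3 * (d * h) := by
  have hdh : 0 ≤ d * h := by positivity
  have hq : ∀ x : Eucl d, |‖mv θ.transpose x‖ ^ 2 - ‖x‖ ^ 2| ≤ d * h * ‖x‖ ^ 2 := fun x => by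
    rw [norm_mv_transpose_sq, norm_sq_eq_sum]
    exact abs_quadratic_sub_le h0 hent _
  have h1 : ‖mv θ‖ ≤ 1 + d * h := by
    rw [← norm_mv_transpose]
    refine ContinuousLinearMap.opNorm_le_bound _ (by positivity) fun x => ?_
    refine le_of_sq_le_sq ?_ (by positivity)
    have := (abs_le.1 (hq x)).2
    nlinarith [sq_nonneg ‖x‖, mul_nonneg (mul_self_nonneg (d * h)) (sq_nonneg ‖x‖)]
  have h2 : ‖mv θ⁻¹‖ ≤ 1 + d * h := by
    rw [← norm_mv_transpose]
    refine ContinuousLinearMap.opNorm_le_bound _ (by positivity) fun y => ?_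
    refine le_of_sq_le_sq ?_ (by positivity)
    set x := mv (θ⁻¹).transpose y
    have hxy : mv θ.transpose x = y := by
      rw [← mv_mul, ← Matrix.transpose_mul, Matrix.nonsing_inv_mul _ hθ, Matrix.transpose_one,
        mv_one]
    have h3 := (abs_le.1 (hq x)).1
    rw [hxy] at h3
    have h4 : ‖x‖ ^ 2 * (1 - d * h) ≤ ‖y‖ ^ 2 := by linarith
    have h5 : 1 ≤ (1 - d * h) * (1 + d * h) ^ 2 := by nlinarith [mul_nonneg hdh hdh]
    calc ‖x‖ ^ 2 ≤ ‖x‖ ^ 2 * ((1 - d * h) * (1 + d * h) ^ 2) :=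
          le_mul_of_one_le_right (sq_nonneg _) h5
      _ = (‖x‖ ^ 2 * (1 - d * h)) * (1 + d * h) ^ 2 := by ring
      _ ≤ ‖y‖ ^ 2 * (1 + d * h) ^ 2 := mul_le_mul_of_nonneg_right h4 (sq_nonneg _)
      _ = ((1 + d * h) * ‖y‖) ^ 2 := by ring
  unfold cond2
  calc ‖mv θ‖ * ‖mv θ⁻¹‖ ≤ (1 + d * h) * (1 + d * h) :=
        mul_le_mul h1 h2 (norm_nonneg _) (by positivity)
    _ ≤ 1 + 3 * (d * h) := by nlinarith

/-- Unit rows give `‖θ‖₂ ≥ 1`, so the bound on the condition number controls `θ⁻¹` alone. -/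
theorem abs_inv_apply_le_cond2 [NeZero d] {θ : Mat d} (h : ∀ i, ∑ j, θ i j ^ 2 = 1)
    (i j : Fin d) : |θ⁻¹ i j| ≤ cond2 θ :=
  (abs_apply_le_norm_mv _ i j).trans
    (le_mul_of_one_le_left (norm_nonneg _) (one_le_norm_mv_of_unit_rows h))

/-! ### The off-diagonal energy -/

/-- The sum of the squared Frobenius norms of the off-diagonal parts. -/
def offDiagEnergy (v : CoSpace d) : ℝ :=
  ∑ ν, frobNorm (v ν - Matrix.diagonal (v ν).diag) ^ 2

theorem sq_le_offDiagEnergy (v : CoSpace d) (ν : Fin (d + 1)) {i j : Fin d} (hij : i ≠ j) :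
    v ν i j ^ 2 ≤ offDiagEnergy v := by
  have h := sq_le_frobNorm_sq (v ν - Matrix.diagonal (v ν).diag) i j
  rw [Matrix.sub_apply, Matrix.diagonal_apply_ne _ hij, sub_zero] at h
  exact h.trans (Finset.single_le_sum
    (f := fun ν => frobNorm (v ν - Matrix.diagonal (v ν).diag) ^ 2)
    (fun _ _ => sq_nonneg _) (Finset.mem_univ ν))

theorem offDiagEnergy_le {v : CoSpace d} {b : ℝ} (hb : 0 ≤ b)
    (h : ∀ ν i j, i ≠ j → |v ν i j| ≤ b) : offDiagEnergy v ≤ (d + 1) * (d * b) ^ 2 := by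
  unfold offDiagEnergy
  refine (Finset.sum_le_card_nsmul _ _ ((d * b) ^ 2) fun ν _ => frobNorm_sq_le fun i j => ?_).trans
    (by simp)
  by_cases hij : i = j
  · subst hij
    simpa using hb
  · rw [Matrix.sub_apply, Matrix.diagonal_apply_ne _ hij, sub_zero]
    exact h ν i j hij

theorem abs_apply_le_coNorm (v : CoSpace d) (ν : Fin (d + 1)) (i j : Fin d) :
    |v ν i j| ≤ coNorm v := by
  refine abs_le_of_sq_le_sq' ?_ (Real.sqrt_nonneg _) |> abs_le.2
  rw [coNorm, Real.sq_sqrt (Finset.sum_nonneg fun _ _ => sq_nonneg _)]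
  exact (sq_le_frobNorm_sq _ i j).trans (Finset.single_le_sum (f := fun ν => frobNorm (v ν) ^ 2)
    (fun _ _ => sq_nonneg _) (Finset.mem_univ ν))

/-! ### Whitening -/

/-- The symmetric part of a matrix. -/
def symPart (G : Mat d) : Mat d := (1 / 2 : ℝ) • (G + G.transpose)

theorem symPart_apply (G : Mat d) (a b : Fin d) : symPart G a b = (G a b + G b a) / 2 := by
  simp [symPart]
  ring

theorem transpose_symPart (G : Mat d) : (symPart G).transpose = symPart G := by
  ext a b
  simp only [Matrix.transpose_apply, symPart_apply]
  ring

theorem symPart_mul_mul_transpose (B G : Mat d) :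
    symPart (B * G * B.transpose) = B * symPart G * B.transpose := by
  simp [symPart, Matrix.transpose_mul, mul_add, add_mul, Matrix.mul_assoc]

theorem covMat_eq_symPart (μ : Measure (PathSpace d)) :
    covMat μ = symPart (coredinates μ 0) := rfl

theorem abs_symPart_sub_one_le {G : Mat d} {δ : ℝ}
    (hG : ∀ a b, |G a b - (1 : Mat d) a b| ≤ δ) (a b : Fin d) :
    |symPart G a b - (1 : Mat d) a b| ≤ δ := by
  have h1 := abs_le.1 (hG a b)
  have h2 := abs_le.1 (hG b a)
  have h3 : (1 : Mat d) b a = (1 : Mat d) a b := by simp [Matrix.one_apply, eq_comm]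
  rw [h3] at h2
  rw [symPart_apply, abs_le]
  constructor <;> linarith [h1.1, h1.2, h2.1, h2.2]

theorem mul_mul_transpose_apply (U G : Mat d) (i j : Fin d) :
    (U * G * U.transpose) i j = ∑ a, ∑ b, U i a * U j b * G a b := by
  simp_rw [Matrix.mul_apply, Matrix.transpose_apply, Finset.sum_mul]
  rw [Finset.sum_comm]
  exact Finset.sum_congr rfl fun a _ => Finset.sum_congr rfl fun b _ => by ring

theorem posDef_symPart {G : Mat d} {δ : ℝ} (hδ : 0 ≤ δ) (hdδ : d * δ < 1)
    (hG : ∀ a b, |G a b - (1 : Mat d) a b| ≤ δ) : (symPart G).PosDef := by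
  refine Matrix.PosDef.of_dotProduct_mulVec_pos ?_ fun u hu => ?_
  · rw [Matrix.IsHermitian, Matrix.conjTranspose_eq_transpose_of_trivial, transpose_symPart]
  · have h1 := (abs_le.1 (abs_quadratic_sub_le hδ (abs_symPart_sub_one_le hG) u)).1
    have h2 : 0 < ∑ a, u a ^ 2 := by
      obtain ⟨a, ha⟩ := Function.ne_iff.1 hu
      exact Finset.sum_pos' (fun _ _ => sq_nonneg _) ⟨a, Finset.mem_univ a, (pow_two_pos_of_ne_zero ha)⟩
    have h3 : star u ⬝ᵥ (symPart G).mulVec u = ∑ a, ∑ b, u a * u b * symPart G a b := by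
      simp only [dotProduct, Matrix.mulVec, star_trivial, Finset.mul_sum]
      exact Finset.sum_congr rfl fun a _ => Finset.sum_congr rfl fun b _ => by ring
    rw [h3]
    nlinarith

open scoped MatrixOrder in
theorem transpose_whitening (μ : Measure (PathSpace d)) :
    (whitening μ).transpose = whitening μ := by
  have h : (whitening μ).PosSemidef := Matrix.nonneg_iff_posSemidef.1 (CFC.sqrt_nonneg _)
  have := h.isHermitian
  rwa [Matrix.IsHermitian, Matrix.conjTranspose_eq_transpose_of_trivial] at this

open scoped MatrixOrder in
theorem whitening_mul_covMat_mul_whitening {μ : Measure (PathSpace d)} (h : (covMat μ).PosDef) :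
    whitening μ * covMat μ * whitening μ = 1 := by
  have h1 : whitening μ * whitening μ = (covMat μ)⁻¹ :=
    CFC.sqrt_mul_sqrt_self _ (Matrix.nonneg_iff_posSemidef.2 h.inv.posSemidef)
  have h2 : whitening μ * (whitening μ * covMat μ) = 1 := by
    rw [← Matrix.mul_assoc, h1, Matrix.nonsing_inv_mul _ ((Matrix.isUnit_iff_isUnit_det _).1 h.isUnit)]
  exact mul_eq_one_comm.1 h2

/-! ### Standardised moments -/

theorem standardise_zero_apply (s : Fin d → ℝ) (v : CoSpace d) (i j : Fin d) :
    standardise s v 0 i j = (√(s i))⁻¹ * v 0 i j * (√(s j))⁻¹ := by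
  simp [standardise, Matrix.mul_diagonal, Matrix.diagonal_mul]

theorem standardise_succ_apply (s : Fin d → ℝ) (v : CoSpace d) (ν i j : Fin d) :
    standardise s v ν.succ i j = (√(s i))⁻¹ * ((√(s ν))⁻¹ * v ν.succ i j) * (√(s j))⁻¹ := by
  simp only [standardise, Fin.cons_succ]
  rw [Matrix.mul_diagonal, Matrix.diagonal_mul, Matrix.smul_apply, smul_eq_mul]

theorem coredinates_zero_apply (μ : Measure (PathSpace d)) (i j : Fin d) :
    coredinates μ 0 i j = sigMoment μ [i, j] := rfl

theorem coredinates_succ_apply (μ : Measure (PathSpace d)) (ν i j : Fin d) :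
    coredinates μ ν.succ i j = sigMoment μ [i, j, ν] := rfl

/-- The inverse standard deviations `⟨μ⟩_{aa}^{-1/2}`. -/
def invStd (μ : Measure (PathSpace d)) (a : Fin d) : ℝ := (√(diagMoment μ a))⁻¹

/-- The moments of second order of `μ'`, standardised by `μ`. -/
def scaledTwo (μ μ' : Measure (PathSpace d)) : Mat d :=
  Matrix.of fun a b => invStd μ a * invStd μ b * sigMoment μ' [a, b]

/-- The moments of third order of `μ'`, standardised by `μ`. -/
def scaledThree (μ μ' : Measure (PathSpace d)) (a b c : Fin d) : ℝ :=
  invStd μ a * invStd μ b * invStd μ c * sigMoment μ' [a, b, c]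

theorem IsCoSignal.invStd_pos {μ : Measure (PathSpace d)} (h : IsCoSignal μ) (a : Fin d) :
    0 < invStd μ a :=
  inv_pos.2 (Real.sqrt_pos.2 (h.diagMoment_pos a))

theorem scaledTwo_self {μ : Measure (PathSpace d)} (h : IsIdentifiableSource μ) (a b : Fin d) :
    scaledTwo μ μ a b = (1 : Mat d) a b := by
  rw [scaledTwo, Matrix.of_apply]
  by_cases hab : a = b
  · subst hab
    have h1 := h.1.diagMoment_pos a
    have h2 : √(diagMoment μ a) ≠ 0 := (Real.sqrt_pos.2 h1).ne'
    rw [Matrix.one_apply_eq, ← diagMoment, invStd]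
    nth_rewrite 3 [← Real.mul_self_sqrt h1.le]
    field_simp
  · rw [Matrix.one_apply_ne hab, h.2.2.2.1 a b hab, mul_zero]

theorem scaledThree_self {μ : Measure (PathSpace d)} (h : IsIdentifiableSource μ)
    (a b c : Fin d) :
    scaledThree μ μ a b c = diagTensor (fun a => scaledThree μ μ a a a) a b c := by
  unfold diagTensor
  split_ifs with habc
  · obtain ⟨rfl, rfl⟩ := habc
    rfl
  · rw [scaledThree, h.2.2.2.2 a b c habc, mul_zero]

theorem abs_scaledTwo_sub_one_le {μ : Measure (PathSpace d)} (h : IsIdentifiableSource μ)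
    (μ' : Measure (PathSpace d)) (a b : Fin d) :
    |scaledTwo μ μ' a b - (1 : Mat d) a b| ≤ premetric μ μ' := by
  rw [← scaledTwo_self h]
  refine le_trans (le_of_eq (congrArg _ ?_)) (abs_apply_le_coNorm _ 0 a b)
  rw [standardise_zero_apply, Pi.sub_apply, Matrix.sub_apply, coredinates_zero_apply,
    coredinates_zero_apply]
  simp only [scaledTwo, invStd, Matrix.of_apply]
  ring

theorem abs_scaledThree_sub_le {μ : Measure (PathSpace d)} (h : IsIdentifiableSource μ)
    (μ' : Measure (PathSpace d)) (a b c : Fin d) :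
    |scaledThree μ μ' a b c - diagTensor (fun a => scaledThree μ μ a a a) a b c| ≤
      premetric μ μ' := by
  rw [← scaledThree_self h]
  refine le_trans (le_of_eq (congrArg _ ?_)) (abs_apply_le_coNorm _ c.succ a b)
  rw [standardise_succ_apply, Pi.sub_apply, Matrix.sub_apply, coredinates_succ_apply,
    coredinates_succ_apply]
  simp only [scaledThree, invStd]
  ring

theorem premetric_nonneg (μ μ' : Measure (PathSpace d)) : 0 ≤ premetric μ μ' :=
  Real.sqrt_nonneg _

theorem HasMoments.sigMoment_act_two_eq_scaledTwo {μ μ' : Measure (PathSpace d)}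
    (hμ' : HasMoments μ') {B U : Mat d} (hB : IsUnit B.det)
    (hBU : ∀ i a, B i a = U i a * invStd μ a) (i j : Fin d) :
    sigMoment (SigICA.act B μ') [i, j] = ∑ a, ∑ b, U i a * U j b * scaledTwo μ μ' a b := by
  rw [hμ'.sigMoment_act_two hB]
  refine Finset.sum_congr rfl fun a _ => Finset.sum_congr rfl fun b _ => ?_
  rw [hBU, hBU, scaledTwo, Matrix.of_apply]
  ring

theorem HasMoments.sigMoment_act_three_eq_scaledThree {μ μ' : Measure (PathSpace d)}
    (hμ' : HasMoments μ') {B U : Mat d} (hB : IsUnit B.det)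
    (hBU : ∀ i a, B i a = U i a * invStd μ a) (i j k : Fin d) :
    sigMoment (SigICA.act B μ') [i, j, k] =
      ∑ a, ∑ b, ∑ c, U i a * U j b * U k c * scaledThree μ μ' a b c := by
  rw [hμ'.sigMoment_act_three hB]
  refine Finset.sum_congr rfl fun a _ => Finset.sum_congr rfl fun b _ =>
    Finset.sum_congr rfl fun c _ => ?_
  rw [hBU, hBU, hBU, scaledThree]
  ring

theorem HasMoments.coredinates_act_zero {μ : Measure (PathSpace d)} (hμ : HasMoments μ)
    {A : Mat d} (hA : IsUnit A.det) :
    coredinates (SigICA.act A μ) 0 = A * coredinates μ 0 * A.transpose := by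
  ext i j
  rw [mul_mul_transpose_apply, coredinates_zero_apply, hμ.sigMoment_act_two hA]
  rfl

theorem IsCoSignal.invStd_mul_sqrt {μ : Measure (PathSpace d)} (h : IsCoSignal μ) (a : Fin d) :
    invStd μ a * √(diagMoment μ a) = 1 :=
  inv_mul_cancel₀ (Real.sqrt_pos.2 (h.diagMoment_pos a)).ne'

theorem IsCoSignal.coredinates_zero_eq {μ : Measure (PathSpace d)} (h : IsCoSignal μ)
    (μ' : Measure (PathSpace d)) : coredinates μ' 0 =
      Matrix.diagonal (fun a => √(diagMoment μ a)) * scaledTwo μ μ' *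
        (Matrix.diagonal fun a => √(diagMoment μ a)).transpose := by
  ext a b
  rw [Matrix.diagonal_transpose, Matrix.mul_diagonal, Matrix.diagonal_mul, scaledTwo,
    Matrix.of_apply, coredinates_zero_apply]
  have h1 := h.invStd_mul_sqrt a
  have h2 := h.invStd_mul_sqrt b
  calc sigMoment μ' [a, b] = (invStd μ a * √(diagMoment μ a)) *
        (invStd μ b * √(diagMoment μ b)) * sigMoment μ' [a, b] := by rw [h1, h2]; ring
    _ = _ := by ring

theorem IsCoSignal.isUnit_det_diagonal_sqrt {μ : Measure (PathSpace d)} (h : IsCoSignal μ) :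
    IsUnit (Matrix.diagonal fun a => √(diagMoment μ a)).det := by
  rw [Matrix.det_diagonal, isUnit_iff_ne_zero, Finset.prod_ne_zero_iff]
  exact fun a _ => (Real.sqrt_pos.2 (h.diagMoment_pos a)).ne'

/-- Whitening a linear image `A · μ'` of a signal `μ'` close to a source `μ`. -/
theorem whitening_act_identity {μ μ' : Measure (PathSpace d)} (h : IsIdentifiableSource μ)
    (hμ' : HasMoments μ') {A : Mat d} (hA : IsUnit A.det) (hδ : d * premetric μ μ' < 1) :
    (whitening (act A μ') * (A * Matrix.diagonal fun a => √(diagMoment μ a))) *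
      symPart (scaledTwo μ μ') *
      (whitening (act A μ') * (A * Matrix.diagonal fun a => √(diagMoment μ a))).transpose = 1 := by
  set D : Mat d := Matrix.diagonal fun a => √(diagMoment μ a) with hD
  have hcov : covMat (act A μ') =
      A * D * symPart (scaledTwo μ μ') * (A * D).transpose := by
    rw [covMat_eq_symPart, hμ'.coredinates_act_zero hA, h.1.coredinates_zero_eq μ',
      ← symPart_mul_mul_transpose, Matrix.transpose_mul]
    simp only [Matrix.mul_assoc]
    rfl
  have hAD : IsUnit (A * D).det := by
    rw [Matrix.det_mul]
    exact hA.mul h.1.isUnit_det_diagonal_sqrt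
  have hpos : (covMat (act A μ')).PosDef := by
    rw [hcov, ← Matrix.conjTranspose_eq_transpose_of_trivial]
    exact (posDef_symPart (premetric_nonneg μ μ') hδ
      (abs_scaledTwo_sub_one_le h μ')).mul_mul_conjTranspose_same
        (Matrix.vecMul_injective_of_isUnit ((Matrix.isUnit_iff_isUnit_det _).2 hAD))
  have hw := whitening_mul_covMat_mul_whitening hpos
  rw [hcov] at hw
  rw [Matrix.transpose_mul, transpose_whitening]
  simpa only [Matrix.mul_assoc] using hw

/-- This removes the normalisation at candidates with unit rows, where the statistics become
polynomial in the candidate. -/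
theorem normStat_eq_coredinates {μ : Measure (PathSpace d)} (h : ∀ i, diagMoment μ i = 1) :
    normStat μ = coredinates μ := by
  funext ν
  ext i j
  refine Fin.cases ?_ (fun ν => ?_) ν
  · simp [normStat, standardise_zero_apply, h]
  · simp [normStat, standardise_succ_apply, h]

theorem contrast_eq_offDiagEnergy (μ : Measure (PathSpace d)) (θ : Mat d) :
    contrast μ θ = offDiagEnergy (normStat (act (θ * whitening μ) μ)) := rfl

/-! ### Candidates of the optimisation -/

/-- A quadratic form sees only the symmetric part. Whitening with the symmetrised matrix `C_μ`
therefore still normalises the diagonal moments of the possibly asymmetric `[μ]_0`. -/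
theorem sum_sum_symPart (u : Fin d → ℝ) (G : Mat d) :
    ∑ a, ∑ b, u a * u b * symPart G a b = ∑ a, ∑ b, u a * u b * G a b := by
  have h : ∑ a, ∑ b, u a * u b * G b a = ∑ a, ∑ b, u a * u b * G a b := by
    rw [Finset.sum_comm]
    exact Finset.sum_congr rfl fun a _ => Finset.sum_congr rfl fun b _ => by ring
  have h2 : ∑ a, ∑ b, u a * u b * symPart G a b =
      ((∑ a, ∑ b, u a * u b * G a b) + ∑ a, ∑ b, u a * u b * G b a) / 2 := by
    rw [← Finset.sum_add_distrib, Finset.sum_div]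
    simp_rw [← Finset.sum_add_distrib, Finset.sum_div, symPart_apply]
    exact Finset.sum_congr rfl fun a _ => Finset.sum_congr rfl fun b _ => by ring
  rw [h2, h]
  ring

theorem sum_sum_scaled_eq_mul_transpose {G W θ : Mat d}
    (hW : W * symPart G * W.transpose = 1) :
    (θ * W) * symPart G * (θ * W).transpose = θ * θ.transpose := by
  calc (θ * W) * symPart G * (θ * W).transpose
      = θ * (W * symPart G * W.transpose) * θ.transpose := by
        simp only [Matrix.transpose_mul, Matrix.mul_assoc]
    _ = _ := by rw [hW, Matrix.mul_one]

theorem mul_transpose_self_apply (θ : Mat d) (i : Fin d) :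
    (θ * θ.transpose) i i = ∑ j, θ i j ^ 2 := by
  simp [Matrix.mul_apply, sq]

theorem sum_sum_eq_one_of_unit_rows {G W θ : Mat d} (hW : W * symPart G * W.transpose = 1)
    (hθ : ∀ i, ∑ j, θ i j ^ 2 = 1) (i : Fin d) :
    ∑ a, ∑ b, (θ * W) i a * (θ * W) i b * G a b = 1 := by
  rw [← sum_sum_symPart, ← mul_mul_transpose_apply, sum_sum_scaled_eq_mul_transpose hW,
    mul_transpose_self_apply, hθ]

/-- The transformation from the standardised source to a candidate is well-conditioned. -/
theorem exists_bounded_leftInverse [NeZero d] {G W θ : Mat d} {δ κ : ℝ} (hδ : 0 ≤ δ)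
    (hdδ : d * δ ≤ 1 / 2) (hG : ∀ a b, |G a b - (1 : Mat d) a b| ≤ δ)
    (hW : W * symPart G * W.transpose = 1) (hθ : ∀ i, ∑ j, θ i j ^ 2 = 1)
    (hdet : IsUnit θ.det) (hκ : cond2 θ ≤ κ) :
    (∀ i a, |(θ * W) i a| ≤ 2) ∧
      ∃ V : Mat d, V * (θ * W) = 1 ∧ ∀ a i, |V a i| ≤ 4 * d ^ 3 * κ ^ 2 := by
  have hn : (1 : ℝ) ≤ d := by exact_mod_cast NeZero.one_le
  have hU : ∀ i a, |(θ * W) i a| ≤ 2 := by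
    intro i a
    -- Row `i` of `θ W` has form value `1` under `G`, so its squared norm is at most `1 / (1 - d δ)
    -- ≤ 2`.
    have h1 := (abs_le.1 (abs_quadratic_sub_le hδ hG fun a => (θ * W) i a)).1
    rw [sum_sum_eq_one_of_unit_rows hW hθ] at h1
    have h2 : (θ * W) i a ^ 2 ≤ ∑ a, (θ * W) i a ^ 2 :=
      Finset.single_le_sum (f := fun a => (θ * W) i a ^ 2) (fun _ _ => sq_nonneg _)
        (Finset.mem_univ a)
    refine abs_le.2 (abs_le_of_sq_le_sq' ?_ zero_le_two)
    nlinarith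
  -- With `U = θ W`, the identity `U (symPart G) Uᵀ = θ θᵀ` exhibits this matrix as the inverse of
  -- `U`, bounded through `θ⁻¹`.
  refine ⟨hU, symPart G * (θ * W).transpose * ((θ⁻¹).transpose * θ⁻¹), ?_, fun a i => ?_⟩
  · refine mul_eq_one_comm.1 ?_
    calc (θ * W) * (symPart G * (θ * W).transpose * ((θ⁻¹).transpose * θ⁻¹))
        = ((θ * W) * symPart G * (θ * W).transpose) * ((θ⁻¹).transpose * θ⁻¹) := by
          simp only [Matrix.mul_assoc]
      _ = θ * (θ⁻¹ * θ).transpose * θ⁻¹ := by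
          rw [sum_sum_scaled_eq_mul_transpose hW, Matrix.transpose_mul]
          simp only [Matrix.mul_assoc]
      _ = 1 := by
          rw [Matrix.nonsing_inv_mul _ hdet, Matrix.transpose_one, Matrix.mul_one,
            Matrix.mul_nonsing_inv _ hdet]
  · have hGs : ∀ a b, |symPart G a b| ≤ 2 := by
      intro a b
      have h1 := abs_le.1 (abs_symPart_sub_one_le hG a b)
      have h2 : (1 : Mat d) a b = 0 ∨ (1 : Mat d) a b = 1 := by
        rw [Matrix.one_apply]
        split_ifs <;> simp
      have h3 : δ ≤ 1 / 2 := by nlinarith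
      rw [abs_le]
      rcases h2 with h2 | h2 <;> rw [h2] at h1 <;> constructor <;> linarith [h1.1, h1.2]
    have hinv : ∀ i j, |θ⁻¹ i j| ≤ κ := fun i j => (abs_inv_apply_le_cond2 hθ i j).trans hκ
    have h1 : ∀ i j, |(symPart G * (θ * W).transpose) i j| ≤ d * (2 * 2) :=
      abs_matrix_mul_apply_le hGs fun i j => hU j i
    have h2 : ∀ i j, |((θ⁻¹).transpose * θ⁻¹) i j| ≤ d * (κ * κ) :=
      abs_matrix_mul_apply_le (fun i j => hinv j i) hinv
    exact (abs_matrix_mul_apply_le h1 h2 a i).trans (le_of_eq (by ring))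

/-- A candidate that almost recovers the standardised source. -/
theorem exists_unmixing_candidate [NeZero d] {G W : Mat d} {δ : ℝ} (hδ : 0 ≤ δ)
    (hdδ : d * (4 * δ) ≤ 1 / 2) (hG : ∀ a b, |G a b - (1 : Mat d) a b| ≤ δ)
    (hW : W * symPart G * W.transpose = 1) :
    ∃ (θ : Mat d) (l : Fin d → ℝ), (∀ i, ∑ j, θ i j ^ 2 = 1) ∧ IsUnit θ.det ∧
      cond2 θ ≤ 1 + 3 * (d * (4 * δ)) ∧ θ * W = Matrix.diagonal l ∧ ∀ i, |l i| ≤ 2 := by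
  have hn : (1 : ℝ) ≤ d := by exact_mod_cast NeZero.one_le
  have hδ2 : δ ≤ 1 / 2 := by nlinarith
  have hdiag : ∀ i, 1 / 2 ≤ G i i := fun i => by
    have := (abs_le.1 (hG i i)).1
    rw [Matrix.one_apply_eq] at this
    linarith
  set l : Fin d → ℝ := fun i => (√(G i i))⁻¹ with hl
  have hlpos : ∀ i, 0 < l i := fun i =>
    inv_pos.2 (Real.sqrt_pos.2 (by linarith [hdiag i]))
  have hl2 : ∀ i, |l i| ≤ 2 := fun i => by
    rw [abs_of_pos (hlpos i)]
    refine inv_le_of_inv_le₀ two_pos (Real.le_sqrt_of_sq_le ?_)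
    linarith [hdiag i]
  have hleft : symPart G * W.transpose * W = 1 := mul_eq_one_comm.1 (by rwa [← Matrix.mul_assoc])
  -- Since `symPart G * Wᵀ = W⁻¹`, this is `diag(l) W⁻¹`. The weights `l i = (G i i)^{-1/2}` give it
  -- unit rows, and `l ≤ 2` bounds the off-diagonal entries of `θ θᵀ` by `4 δ`.
  set θ : Mat d := Matrix.diagonal l * (symPart G * W.transpose) with hθ
  have hθW : θ * W = Matrix.diagonal l := by
    rw [hθ, Matrix.mul_assoc, hleft, Matrix.mul_one]
  have hθθ : θ * θ.transpose = Matrix.diagonal l * symPart G * Matrix.diagonal l := by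
    rw [← sum_sum_scaled_eq_mul_transpose hW, hθW, Matrix.diagonal_transpose]
  have hent : ∀ a b, (θ * θ.transpose) a b = l a * symPart G a b * l b := fun a b => by
    rw [hθθ, Matrix.mul_diagonal, Matrix.diagonal_mul]
  have hone : ∀ i, (θ * θ.transpose) i i = 1 := fun i => by
    have h1 : (0 : ℝ) < G i i := by linarith [hdiag i]
    have h2 : √(G i i) ≠ 0 := (Real.sqrt_pos.2 h1).ne'
    rw [hent, symPart_apply, hl]
    have h3 := Real.sq_sqrt h1.le
    field_simp
    linarith
  have hdet : IsUnit θ.det := by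
    have h1 : θ.det * W.det = ∏ i, l i := by rw [← Matrix.det_mul, hθW, Matrix.det_diagonal]
    have h2 : ∏ i, l i ≠ 0 := Finset.prod_ne_zero_iff.2 fun i _ => (hlpos i).ne'
    exact isUnit_iff_ne_zero.2 fun h0 => h2 (by rw [← h1, h0, zero_mul])
  refine ⟨θ, l, fun i => by rw [← mul_transpose_self_apply, hone], hdet, ?_, hθW, hl2⟩
  refine cond2_le_of_almost_orthogonal hdet (by positivity) hdδ fun a b => ?_
  by_cases hab : a = b
  · subst hab
    rw [hone, Matrix.one_apply_eq, sub_self, abs_zero]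
    positivity
  · have h1 := abs_symPart_sub_one_le hG a b
    rw [Matrix.one_apply_ne hab, sub_zero] at h1 ⊢
    rw [hent]
    exact (abs_mul_le_mul (abs_mul_le_mul (hl2 a) h1) (hl2 b)).trans (le_of_eq (by ring))

/-! ### Monomial factors -/

/-- `M` keeps the entries of `B` at the positions `(τ a, a)`. Its inverse is explicit, and `E = M⁻¹
(B - M)`. -/
theorem exists_monomial_factor {B : Mat d} {τ : Equiv.Perm (Fin d)} {b p e : ℝ} (hb0 : 0 ≤ b)
    (hp0 : 0 ≤ p) (he0 : 0 ≤ e) (hne : ∀ a, B (τ a) a ≠ 0) (hb : ∀ i a, |B i a| ≤ b)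
    (hp : ∀ a, |(B (τ a) a)⁻¹| ≤ p) (he : ∀ a j, j ≠ τ a → |B j a| ≤ e) :
    ∃ M : Mat d, IsMonomial M ∧ frobNorm M ≤ d * b ∧ (∀ u, ‖u‖ ≤ d * p * ‖mv M u‖) ∧
      ∃ E : Mat d, frobNorm E ≤ d * (d * (p * e)) ∧ B = M * (1 + E) := by
  set M : Mat d := Matrix.of fun i a => if i = τ a then B i a else 0 with hM
  set M' : Mat d := Matrix.of fun a i => if i = τ a then (B i a)⁻¹ else 0 with hM'
  have hM'M : M' * M = 1 := by
    ext a c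
    rw [Matrix.mul_apply, Finset.sum_eq_single (τ a)]
    · by_cases hac : a = c
      · subst hac
        simp [hM, hM', hne]
      · simp [hM, hac]
    · intro i _ hi
      simp [hM', hi]
    · simp
  have hMM' : M * M' = 1 := mul_eq_one_comm.1 hM'M
  have hM'ent : ∀ a i, |M' a i| ≤ p := by
    intro a i
    by_cases hi : i = τ a
    · subst hi
      simpa [hM'] using hp a
    · simpa [hM', hi] using hp0
  have hsub : ∀ i a, |(B - M) i a| ≤ e := by
    intro i a
    by_cases hi : i = τ a
    · subst hi
      simpa [hM] using he0
    · simpa [hM, hi] using he a i hi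
  refine ⟨M, ⟨fun i => B i (τ.symm i), τ.symm, fun i => ?_, ?_⟩, frobNorm_le hb0 fun i a => ?_,
    fun u => ?_, M' * (B - M), frobNorm_le (by positivity) (abs_matrix_mul_apply_le hM'ent hsub),
    ?_⟩
  · simpa using hne (τ.symm i)
  · ext i a
    rw [Matrix.diagonal_mul, Equiv.Perm.permMatrix, PEquiv.toMatrix_apply]
    by_cases hi : i = τ a
    · subst hi
      simp [hM]
    · have : ¬ τ.symm i = a := fun h => hi (by rw [← h, Equiv.apply_symm_apply])
      simp [hM, hi, this]
  · by_cases hi : i = τ a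
    · simpa [hM, hi] using hb (τ a) a
    · simpa [hM, hi] using hb0
  · calc ‖u‖ = ‖mv M' (mv M u)‖ := by rw [← mv_mul, hM'M, mv_one]
      _ ≤ frobNorm M' * ‖mv M u‖ := norm_mv_le_frobNorm _ _
      _ ≤ d * p * ‖mv M u‖ :=
          mul_le_mul_of_nonneg_right (frobNorm_le hp0 hM'ent) (norm_nonneg _)
  · rw [mul_add, Matrix.mul_one, ← Matrix.mul_assoc, hMM', Matrix.one_mul, add_sub_cancel]

/-! ### Robustness of the minimisers -/

theorem isUnit_det_of_mul_mul_transpose_eq_one {W G : Mat d}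
    (h : W * G * W.transpose = 1) : IsUnit W.det := by
  refine isUnit_iff_ne_zero.2 fun h0 => ?_
  have := congrArg Matrix.det h
  rw [Matrix.det_mul, Matrix.det_mul, h0, Matrix.det_one] at this
  simp at this

/-- Turns the contrast bound of the competitor into a bound on single off-diagonal statistics of a
minimiser. -/
theorem abs_le_of_sq_le_of_card {x δ : ℝ} [NeZero d] (hδ : 0 ≤ δ)
    (h : x ^ 2 ≤ (d + 1) * (d * (8 * δ)) ^ 2) : |x| ≤ 16 * d ^ 2 * δ := by
  have hn : (1 : ℝ) ≤ d := by exact_mod_cast NeZero.one_le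
  refine abs_le.2 (abs_le_of_sq_le_sq' (h.trans ?_) (by positivity))
  have h1 : (d : ℝ) + 1 ≤ 4 * d ^ 2 := by nlinarith
  calc ((d : ℝ) + 1) * (d * (8 * δ)) ^ 2 ≤ 4 * d ^ 2 * (d * (8 * δ)) ^ 2 :=
        mul_le_mul_of_nonneg_right h1 (sq_nonneg _)
    _ = (16 * d ^ 2 * δ) ^ 2 := by ring

section Candidates

variable {μ μ' : Measure (PathSpace d)}

/-- The matrix that whitens the standardised source. -/
def sourceWhitening (μ μ' : Measure (PathSpace d)) (A : Mat d) : Mat d :=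
  whitening (act A μ') * (A * Matrix.diagonal fun a => √(diagMoment μ a))

theorem IsCoSignal.mul_whitening_mul_apply (h : IsCoSignal μ) (A θ : Mat d) (i a : Fin d) :
    (θ * whitening (act A μ') * A) i a = (θ * sourceWhitening μ μ' A) i a * invStd μ a := by
  have h1 : θ * sourceWhitening μ μ' A = θ * whitening (act A μ') * A *
      Matrix.diagonal fun a => √(diagMoment μ a) := by
    simp only [sourceWhitening, Matrix.mul_assoc]
  rw [h1, Matrix.mul_diagonal]
  linear_combination (-(θ * whitening (act A μ') * A) i a) * h.invStd_mul_sqrt a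

theorem isUnit_det_whitening (h : IsIdentifiableSource μ) (hμ' : HasMoments μ') {A : Mat d}
    (hA : IsUnit A.det) (hδ : d * premetric μ μ' < 1) : IsUnit (whitening (act A μ')).det := by
  have h1 := isUnit_det_of_mul_mul_transpose_eq_one (whitening_act_identity h hμ' hA hδ)
  rw [Matrix.det_mul] at h1
  exact isUnit_of_mul_isUnit_left h1

/-- The normalised statistics at a candidate with unit rows. -/
theorem normStat_candidate (h : IsIdentifiableSource μ) (hμ' : HasMoments μ') {A : Mat d}
    (hA : IsUnit A.det) (hδ : d * premetric μ μ' < 1) {θ : Mat d}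
    (hθ : ∀ i, ∑ j, θ i j ^ 2 = 1) (hdet : IsUnit θ.det) (i j : Fin d) :
    normStat (act (θ * whitening (act A μ')) (act A μ')) 0 i j =
        ∑ a, ∑ b, (θ * sourceWhitening μ μ' A) i a * (θ * sourceWhitening μ μ' A) j b *
          scaledTwo μ μ' a b ∧
      ∀ k, normStat (act (θ * whitening (act A μ')) (act A μ')) k.succ i j =
        ∑ a, ∑ b, ∑ c, (θ * sourceWhitening μ μ' A) i a * (θ * sourceWhitening μ μ' A) j b *
          (θ * sourceWhitening μ μ' A) k c * scaledThree μ μ' a b c := by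
  have hW := whitening_act_identity h hμ' hA hδ
  have hR := isUnit_det_whitening h hμ' hA hδ
  have hB : IsUnit (θ * whitening (act A μ') * A).det := by
    rw [Matrix.det_mul, Matrix.det_mul]
    exact (hdet.mul hR).mul hA
  have hBU := fun i a => h.1.mul_whitening_mul_apply (μ' := μ') A θ i a
  have hdiag : ∀ i, diagMoment (act (θ * whitening (act A μ') * A) μ') i = 1 := fun i => by
    rw [diagMoment, hμ'.sigMoment_act_two_eq_scaledTwo hB hBU]
    exact sum_sum_eq_one_of_unit_rows hW hθ i
  rw [act_act, normStat_eq_coredinates hdiag]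
  exact ⟨hμ'.sigMoment_act_two_eq_scaledTwo hB hBU i j,
    fun k => hμ'.sigMoment_act_three_eq_scaledThree hB hBU i j k⟩

/-- The minimal contrast is small for a signal close to an identifiable source. -/
theorem exists_contrast_le [NeZero d] (h : IsIdentifiableSource μ) (hμ' : HasMoments μ')
    {A : Mat d} (hA : IsUnit A.det) (hδ : d * (4 * premetric μ μ') ≤ 1 / 2) {κ : ℝ}
    (hκ : 1 + 3 * (d * (4 * premetric μ μ')) ≤ κ) :
    ∃ θ ∈ searchDomain d κ,
      contrast (act A μ') θ ≤ (d + 1) * (d * (8 * premetric μ μ')) ^ 2 := by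
  have hδ0 := premetric_nonneg μ μ'
  have hδ1 : d * premetric μ μ' < 1 := by nlinarith
  obtain ⟨θ, l, hrows, hdet, hcond, hθW, hl⟩ := exists_unmixing_candidate hδ0 hδ
    (abs_scaledTwo_sub_one_le h μ') (whitening_act_identity h hμ' hA hδ1)
  refine ⟨θ, ⟨hrows, hdet, hcond.trans hκ⟩, ?_⟩
  rw [contrast_eq_offDiagEnergy]
  refine offDiagEnergy_le (by positivity) fun ν i j hij => ?_
  have hstat := normStat_candidate h hμ' hA hδ1 hrows hdet i j
  have hθW' : θ * sourceWhitening μ μ' A = Matrix.diagonal l := hθW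
  -- For diagonal `U` the sums collapse to `l i * l j * G i j` and `l i * l j * l k * T i j k`,
  -- hence the bounds `4 δ` and `8 δ`.
  simp only [hθW', Matrix.diagonal_apply, ite_mul, mul_ite, zero_mul, mul_zero,
    Finset.sum_ite_eq, Finset.mem_univ, if_true] at hstat
  refine Fin.cases ?_ (fun k => ?_) ν
  · have h1 := abs_scaledTwo_sub_one_le h μ' i j
    rw [Matrix.one_apply_ne hij, sub_zero] at h1
    rw [hstat.1]
    exact (abs_mul_le_mul (abs_mul_le_mul (hl i) (hl j)) h1).trans (by linarith)
  · have h1 := abs_scaledThree_sub_le h μ' i j k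
    rw [diagTensor, if_neg fun h => hij h.1, sub_zero] at h1
    rw [hstat.2]
    exact (abs_mul_le_mul (abs_mul_le_mul (abs_mul_le_mul (hl i) (hl j)) (hl k)) h1).trans
      (by linarith)

end Candidates

theorem exists_pos_le_abs_of_ncard_le_one [NeZero d] {m : Fin d → ℝ}
    (h : {i | m i = 0}.ncard ≤ 1) : ∃ (c : Fin d) (m₀ : ℝ), 0 < m₀ ∧ ∀ a, a ≠ c → m₀ ≤ |m a| := by
  obtain ⟨c, hc⟩ : ∃ c, ∀ a, a ≠ c → m a ≠ 0 := by
    by_cases hex : ∃ c, m c = 0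
    · obtain ⟨c, hc⟩ := hex
      exact ⟨c, fun a hac ha => hac ((Set.ncard_le_one (Set.toFinite _)).1 h a ha c hc)⟩
    · exact ⟨0, fun a _ ha => hex ⟨a, ha⟩⟩
  -- The default `1` at zeros keeps the minimum over all indices positive.
  obtain ⟨a₀, ha₀⟩ := Finite.exists_min fun a => if m a = 0 then (1 : ℝ) else |m a|
  refine ⟨c, _, ?_, fun a hac => (ha₀ a).trans (by rw [if_neg (hc a hac)])⟩
  split_ifs with h0
  · exact one_pos
  · exact abs_pos.2 h0

/-- Minimisers of the contrast of a signal close to an identifiable source are close to the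
product of a monomial matrix and the unmixing matrix. -/
theorem exists_factorisation_of_small_premetric [NeZero d] {μS : Measure (PathSpace d)}
    (hS : IsIdentifiableSource μS) {A : Mat d} (hA : IsUnit A.det) {κ : ℝ} (hκ : 1 < κ) :
    ∃ δ₀ > 0, ∃ K > 0, ∃ c₁ > 0, ∃ c₂ > 0, ∀ μ, HasMoments μ → premetric μS μ < δ₀ →
      ∀ θ ∈ inversion κ (act A μ), ∃ M : Mat d, IsMonomial M ∧ frobNorm M ≤ c₁ ∧
        (∀ u, ‖u‖ ≤ c₂ * ‖mv M u‖) ∧ ∃ E : Mat d, frobNorm E ≤ K * premetric μS μ ∧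
          θ = M * (1 + E) * A⁻¹ := by
  have hn : (1 : ℝ) ≤ d := by exact_mod_cast NeZero.one_le
  have hn0 : (0 : ℝ) < d := by linarith
  set m : Fin d → ℝ := fun a => scaledThree μS μS a a a with hm
  have hm0 : ∀ a, m a = 0 ↔ sigMoment μS [a, a, a] = 0 := fun a => by
    have := (hS.1.invStd_pos a).ne'
    simp [hm, scaledThree, this]
  obtain ⟨c, m₀, hm₀, hmc⟩ := exists_pos_le_abs_of_ncard_le_one (m := m)
    (by simpa only [hm0] using hS.2.2.1)
  -- A common bound for `U` (entries at most `2`) and its inverse (entries at most `4 d³ κ²`).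
  set L : ℝ := 4 * d ^ 3 * κ ^ 2 + 2 with hL
  have hL2 : 2 ≤ L := by rw [hL]; linarith [show 0 ≤ 4 * (d : ℝ) ^ 3 * κ ^ 2 by positivity]
  obtain ⟨δ₁, hδ₁, K, hK, hperm⟩ := exists_perm_of_small_statistics (d := d) (L := L)
    (by linarith) hm₀ (C := 16 * (d : ℝ) ^ 2) (by positivity)
  set N : ℝ := ∑ a, invStd μS a with hN
  set Q : ℝ := ∑ a, √(diagMoment μS a) with hQ
  have hNpos : 0 < N := Finset.sum_pos (fun a _ => hS.1.invStd_pos a) ⟨0, Finset.mem_univ _⟩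
  have hQpos : 0 < Q := Finset.sum_pos
    (fun a _ => Real.sqrt_pos.2 (hS.1.diagMoment_pos a)) ⟨0, Finset.mem_univ _⟩
  have hNle : ∀ a, |invStd μS a| ≤ N := fun a => by
    rw [abs_of_pos (hS.1.invStd_pos a)]
    exact Finset.single_le_sum (f := invStd μS) (fun a _ => (hS.1.invStd_pos a).le)
      (Finset.mem_univ a)
  have hQle : ∀ a, |(invStd μS a)⁻¹| ≤ Q := fun a => by
    rw [invStd, inv_inv, abs_of_nonneg (Real.sqrt_nonneg _)]
    exact Finset.single_le_sum (f := fun a => √(diagMoment μS a))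
      (fun a _ => Real.sqrt_nonneg _) (Finset.mem_univ a)
  -- The radius `1 / (8 d)` gives `4 d δ ≤ 1 / 2`, and `(κ - 1) / (12 d)` keeps the condition number
  -- of the competitor below `κ`. The sums `N` and `Q` bound the entries of `D⁻¹` and `D` in the
  -- passage from `U` to `U D⁻¹`.
  refine ⟨min δ₁ (min (1 / (8 * d)) ((κ - 1) / (12 * d))), ?_,
    d * (d * (2 * d * L * Q * (K * N))), by positivity, d * (2 * N), by positivity,
    d * (2 * d * L * Q), by positivity, ?_⟩
  · have : 0 < κ - 1 := by linarith
    positivity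
  intro μ hμ hδ θ hθ
  set δ := premetric μS μ with hδdef
  have hδ0 : 0 ≤ δ := premetric_nonneg _ _
  obtain ⟨hδ₁', hδ'⟩ := lt_min_iff.1 hδ
  obtain ⟨hδ₂, hδ₃⟩ := lt_min_iff.1 hδ'
  rw [lt_div_iff₀ (by positivity)] at hδ₂ hδ₃
  obtain ⟨θ₀, ⟨hrows, hdet, hcond⟩, hmin, rfl⟩ := hθ
  obtain ⟨θ₁, hθ₁, hcontr⟩ := exists_contrast_le hS hμ hA (by rw [← hδdef]; linarith)
    (κ := κ) (by rw [← hδdef]; linarith)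
  have henergy := (hmin θ₁ hθ₁).trans hcontr
  rw [contrast_eq_offDiagEnergy] at henergy
  have hδlt : d * premetric μS μ < 1 := by rw [← hδdef]; linarith
  have hW : sourceWhitening μS μ A * symPart (scaledTwo μS μ) *
      (sourceWhitening μS μ A).transpose = 1 := whitening_act_identity hS hμ hA hδlt
  obtain ⟨hU, V, hVU, hV⟩ := exists_bounded_leftInverse hδ0 (by linarith)
    (abs_scaledTwo_sub_one_le hS μ) hW hrows hdet hcond
  set U := θ₀ * sourceWhitening μS μ A with hUdef
  have hstat := normStat_candidate hS hμ hA hδlt hrows hdet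
  obtain ⟨τ, hτ⟩ := hperm δ hδ0 hδ₁' U V (scaledTwo μS μ) m (scaledThree μS μ) c
    (fun i a => (hU i a).trans hL2) (fun a i => (hV a i).trans (by linarith)) hVU hmc
    (abs_scaledTwo_sub_one_le hS μ) (abs_scaledThree_sub_le hS μ)
    (fun i j hij => by
      rw [← (hstat i j).1]
      exact abs_le_of_sq_le_of_card hδ0 ((sq_le_offDiagEnergy _ 0 hij).trans henergy))
    (fun i j k hij => by
      rw [← (hstat i j).2 k]
      exact abs_le_of_sq_le_of_card hδ0 ((sq_le_offDiagEnergy _ k.succ hij).trans henergy))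
  have hB : ∀ i a, (θ₀ * whitening (act A μ) * A) i a = U i a * invStd μS a := fun i a =>
    hS.1.mul_whitening_mul_apply A θ₀ i a
  have hUpos : ∀ a, 0 < |U (τ a) a| := fun a =>
    lt_of_lt_of_le (by positivity) (hτ a).1
  obtain ⟨M, hM, hMle, hMinv, E, hE, hfac⟩ := exists_monomial_factor
    (B := θ₀ * whitening (act A μ) * A) (τ := τ) (b := 2 * N) (p := 2 * d * L * Q)
    (e := K * δ * N) (by positivity) (by positivity) (by positivity)
    (fun a => by
      rw [hB]
      exact mul_ne_zero (abs_pos.1 (hUpos a)) (hS.1.invStd_pos a).ne')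
    (fun i a => by
      rw [hB]
      exact abs_mul_le_mul (hU i a) (hNle a))
    (fun a => by
      rw [hB, mul_inv]
      refine abs_mul_le_mul ?_ (hQle a)
      rw [abs_inv]
      refine inv_le_of_inv_le₀ (by positivity) ?_
      rw [← one_div]
      exact (hτ a).1)
    (fun a j hj => by
      rw [hB]
      exact abs_mul_le_mul ((hτ a).2 j hj) (hNle a))
  refine ⟨M, hM, hMle, hMinv, E, hE.trans (le_of_eq (by ring)), ?_⟩
  rw [← hfac, Matrix.mul_assoc _ A, Matrix.mul_nonsing_inv _ hA, Matrix.mul_one]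

theorem isUnit_det_unitRowUnmixing {μ : Measure (PathSpace d)} {A : Mat d}
    (h : IsUnit (whitening (act A μ) * A).det) : IsUnit (unitRowUnmixing A μ).det := by
  have hB : IsUnit ((whitening (act A μ) * A)⁻¹).det := Matrix.isUnit_nonsing_inv_det _ h
  simp only [unitRowUnmixing]
  rw [Matrix.det_mul, Matrix.det_diagonal]
  refine IsUnit.mul (isUnit_iff_ne_zero.2 (Finset.prod_ne_zero_iff.2 fun i _ => ?_)) hB
  refine inv_ne_zero (Real.sqrt_pos.2 ?_).ne'
  by_contra hcon
  have h0 : ∑ j, (whitening (act A μ) * A)⁻¹ i j ^ 2 = 0 :=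
    le_antisymm (not_lt.1 hcon) (Finset.sum_nonneg fun _ _ => sq_nonneg _)
  have hrow : ∀ j, (whitening (act A μ) * A)⁻¹ i j = 0 := fun j => by
    have := (Finset.sum_eq_zero_iff_of_nonneg fun _ _ => sq_nonneg _).1 h0 j (Finset.mem_univ j)
    exact pow_eq_zero_iff two_ne_zero |>.1 this
  exact hB.ne_zero (Matrix.det_eq_zero_of_row_eq_zero i hrow)

theorem premetric_self (μ : Measure (PathSpace d)) : premetric μ μ = 0 := by
  have : standardise (diagMoment μ) (0 : CoSpace d) = 0 := by
    funext ν
    ext i j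
    refine Fin.cases ?_ (fun k => ?_) ν
    · simp [standardise_zero_apply]
    · simp [standardise_succ_apply]
  simp [premetric, premetricFun, this, coNorm, frobNorm]

/-- All that is needed of the reference matrix: adding `Δκ > 0` then gives `κ > 1`, which leaves
room for the competitor. -/
theorem one_le_cond2_unitRowUnmixing [NeZero d] {μ : Measure (PathSpace d)}
    (h : IsIdentifiableSource μ) {A : Mat d} (hA : IsUnit A.det) :
    1 ≤ cond2 (unitRowUnmixing A μ) := by
  refine one_le_cond2 (isUnit_det_unitRowUnmixing ?_)
  rw [Matrix.det_mul]
  exact (isUnit_det_whitening h h.1.hasMoments hA (by simp [premetric_self])).mul hA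

/-! ### Relative errors -/

/-- The error is exactly `θ A u - M u = M E u`, and `‖u‖` is controlled by `‖M u‖`. -/
theorem relError_le {M E A θ : Mat d} (hA : IsUnit A.det) {c₁ c₂ ε : ℝ} (hc₁ : 0 ≤ c₁)
    (hM : frobNorm M ≤ c₁) (hinv : ∀ u, ‖u‖ ≤ c₂ * ‖mv M u‖) (hE : frobNorm E ≤ ε)
    (hθ : θ = M * (1 + E) * A⁻¹) {u : Eucl d} (hu : mv M u ≠ 0) :
    ‖mv θ (mv A u) - mv M u‖ / ‖mv M u‖ ≤ c₁ * c₂ * ε := by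
  have hε : 0 ≤ ε := (frobNorm_nonneg E).trans hE
  have h1 : mv θ (mv A u) - mv M u = mv M (mv E u) := by
    rw [← mv_mul, hθ, Matrix.mul_assoc _ A⁻¹, Matrix.nonsing_inv_mul _ hA, Matrix.mul_one, mv_mul,
      ← map_sub]
    congr 1
    rw [sub_eq_iff_eq_add, add_comm]
    simp [mv, map_add]
  rw [h1, div_le_iff₀ (norm_pos_iff.2 hu)]
  calc ‖mv M (mv E u)‖ ≤ frobNorm M * (frobNorm E * ‖u‖) :=
        (norm_mv_le_frobNorm _ _).trans
          (mul_le_mul_of_nonneg_left (norm_mv_le_frobNorm _ _) (frobNorm_nonneg M))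
    _ ≤ c₁ * (ε * (c₂ * ‖mv M u‖)) :=
        mul_le_mul hM (mul_le_mul hE (hinv u) (norm_nonneg _) hε)
          (mul_nonneg (frobNorm_nonneg E) (norm_nonneg _)) hc₁
    _ = c₁ * c₂ * ε * ‖mv M u‖ := by ring

theorem robustRadius_pos {c : Fin 5 → ℝ} (hc : ∀ i, 0 < c i) {ε : ℝ} (hε : 0 < ε) :
    0 < robustRadius c ε := by
  have h0 := hc 0
  have h1 := hc 1
  have h2 := hc 2
  unfold robustRadius
  positivity

/-- As `δ < 1`, `δ² ≤ δ < (ε / (c₂ + ε))²`, so `c₂ δ + ε δ ≤ ε`. The squared radius is thus stricter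
than the linear dependence proved here requires. -/
theorem mul_le_of_lt_robustRadius {c : Fin 5 → ℝ} (h2 : 0 < c 2) (h0 : c 0 ≤ 1) (h1 : c 1 = 1)
    {δ ε : ℝ} (hδ : 0 ≤ δ) (hε : 0 < ε) (h : δ < robustRadius c ε) : c 2 * δ ≤ ε := by
  obtain ⟨hl, hr⟩ := lt_min_iff.1 h
  rw [h1, one_pow, one_mul] at hr
  have h3 : δ ^ 2 ≤ (ε / (c 2 + ε)) ^ 2 := by nlinarith
  have h4 : δ ≤ ε / (c 2 + ε) := le_of_sq_le_sq h3 (by positivity)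
  rw [le_div_iff₀ (by positivity)] at h4
  nlinarith [mul_nonneg hδ hε.le]

/-! ### The modulus of continuity -/

/-- The tuple of matrices, all of whose entries are one. -/
def onesTuple (d : ℕ) : CoSpace d := fun _ => Matrix.of fun _ _ => 1

theorem abs_apply_le_coSupNorm (v : CoSpace d) (ν : Fin (d + 1)) (i j : Fin d) :
    |v ν i j| ≤ coSupNorm v :=
  le_ciSup (f := fun p : Fin (d + 1) × Fin d × Fin d => |v p.1 p.2.1 p.2.2|)
    (Set.finite_range _).bddAbove (ν, i, j)

theorem coSupNorm_le [NeZero d] {v : CoSpace d} {r : ℝ} (h : ∀ ν i j, |v ν i j| ≤ r) :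
    coSupNorm v ≤ r :=
  ciSup_le fun p => h p.1 p.2.1 p.2.2

theorem coNorm_standardise_le {s : Fin d → ℝ} {v w : CoSpace d}
    (h : ∀ ν i j, |v ν i j| ≤ w ν i j) :
    coNorm (standardise s v) ≤ coNorm (standardise s w) := by
  have hs : ∀ i, 0 ≤ (√(s i))⁻¹ := fun i => inv_nonneg.2 (Real.sqrt_nonneg _)
  have hent : ∀ ν i j, |standardise s v ν i j| ≤ standardise s w ν i j := by
    intro ν i j
    have hi := hs i
    have hj := hs j
    refine Fin.cases ?_ (fun k => ?_) ν
    · rw [standardise_zero_apply, standardise_zero_apply, abs_mul, abs_mul, abs_of_nonneg hi,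
        abs_of_nonneg hj]
      have := h 0 i j
      gcongr
    · have hk := hs k
      rw [standardise_succ_apply, standardise_succ_apply, abs_mul, abs_mul, abs_mul,
        abs_of_nonneg hi, abs_of_nonneg hj, abs_of_nonneg hk]
      have := h k.succ i j
      gcongr
  refine Real.sqrt_le_sqrt (Finset.sum_le_sum fun ν _ => ?_)
  rw [frobNorm, frobNorm, Real.sq_sqrt (by positivity), Real.sq_sqrt (by positivity)]
  exact Finset.sum_le_sum fun i _ => Finset.sum_le_sum fun j _ =>
    sq_le_sq.2 ((hent ν i j).trans (le_abs_self _))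

theorem coNorm_standardise_smul (s : Fin d → ℝ) (v : CoSpace d) {r : ℝ} (hr : 0 ≤ r) :
    coNorm (standardise s (r • v)) = r * coNorm (standardise s v) := by
  have h1 : ∀ ν i j, standardise s (r • v) ν i j = r * standardise s v ν i j := by
    intro ν i j
    refine Fin.cases ?_ (fun k => ?_) ν
    · rw [standardise_zero_apply, standardise_zero_apply, Pi.smul_apply, Matrix.smul_apply,
        smul_eq_mul]
      ring
    · rw [standardise_succ_apply, standardise_succ_apply, Pi.smul_apply, Matrix.smul_apply,
        smul_eq_mul]
      ring
  have h2 : ∀ ν, frobNorm (standardise s (r • v) ν) ^ 2 =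
      r ^ 2 * frobNorm (standardise s v ν) ^ 2 := by
    intro ν
    rw [frobNorm, frobNorm, Real.sq_sqrt (by positivity), Real.sq_sqrt (by positivity)]
    simp_rw [h1, mul_pow, ← Finset.mul_sum]
  unfold coNorm
  simp_rw [h2, ← Finset.mul_sum]
  rw [Real.sqrt_mul (sq_nonneg _), Real.sqrt_sq hr]

/-- The weighted norm is monotone in the absolute values of the entries, so the supremum is attained
when every entry deviates by exactly `r`. -/
theorem modulus_eq [NeZero d] (μ : Measure (PathSpace d)) {r : ℝ} (hr : 0 ≤ r) :
    modulus μ r = r * coNorm (standardise (diagMoment μ) (onesTuple d)) := by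
  rw [← coNorm_standardise_smul _ _ hr]
  refine IsGreatest.csSup_eq ⟨⟨coredinates μ + r • onesTuple d, ?_, ?_⟩, ?_⟩
  · rw [add_sub_cancel_left]
    exact coSupNorm_le fun ν i j => by simp [onesTuple, abs_of_nonneg hr]
  · rw [premetricFun, add_sub_cancel_left]
  · rintro y ⟨v, hv, rfl⟩
    refine coNorm_standardise_le fun ν i j => ?_
    simpa [onesTuple] using (abs_apply_le_coSupNorm (v - coredinates μ) ν i j).trans hv

theorem IsCoSignal.coNorm_standardise_onesTuple_pos [NeZero d] {μ : Measure (PathSpace d)}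
    (h : IsCoSignal μ) : 0 < coNorm (standardise (diagMoment μ) (onesTuple d)) := by
  refine lt_of_lt_of_le ?_ (abs_apply_le_coNorm _ 0 0 0)
  rw [standardise_zero_apply]
  have := h.invStd_pos 0
  rw [invStd] at this
  simp only [onesTuple, Matrix.of_apply]
  positivity

theorem IsCoSignal.invModulus_eq [NeZero d] {μ : Measure (PathSpace d)} (h : IsCoSignal μ)
    {r : ℝ} (hr : 0 ≤ r) :
    invModulus μ r = r / coNorm (standardise (diagMoment μ) (onesTuple d)) := by
  have hpos := h.coNorm_standardise_onesTuple_pos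
  have hex : ∃ ρ ∈ Set.Ici (0 : ℝ), modulus μ ρ = r :=
    ⟨r / coNorm (standardise (diagMoment μ) (onesTuple d)), by
      rw [Set.mem_Ici]; positivity, by
      rw [modulus_eq μ (by positivity), div_mul_cancel₀ _ hpos.ne']⟩
  have hmem : 0 ≤ invModulus μ r := Function.invFunOn_mem hex
  have heq : modulus μ (invModulus μ r) = r := Function.invFunOn_eq hex
  rw [modulus_eq μ hmem] at heq
  rw [eq_div_iff hpos.ne', heq]

theorem IsCoSignal.premetric_lt_of_coSupNorm_lt [NeZero d] {μ μ' : Measure (PathSpace d)}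
    (h : IsCoSignal μ) {r : ℝ} (hr : 0 ≤ r)
    (hlt : coSupNorm (coredinates μ' - coredinates μ) < invModulus μ r) :
    premetric μ μ' < r := by
  have hpos := h.coNorm_standardise_onesTuple_pos
  have h0 : 0 ≤ coSupNorm (coredinates μ' - coredinates μ) :=
    (abs_nonneg _).trans (abs_apply_le_coSupNorm _ 0 0 0)
  rw [h.invModulus_eq hr, lt_div_iff₀ hpos, ← coNorm_standardise_smul _ _ h0] at hlt
  refine lt_of_le_of_lt (coNorm_standardise_le fun ν i j => ?_) hlt
  simpa [onesTuple] using abs_apply_le_coSupNorm (coredinates μ' - coredinates μ) ν i j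

/-! ### Transport of the estimation error -/

theorem rowSumNorm_nonneg (B : Mat d) : 0 ≤ rowSumNorm B :=
  Real.iSup_nonneg fun _ => Finset.sum_nonneg fun _ _ => abs_nonneg _

theorem sum_abs_le_rowSumNorm (B : Mat d) (i : Fin d) : ∑ j, |B i j| ≤ rowSumNorm B :=
  le_ciSup (f := fun i => ∑ j, |B i j|) (Set.finite_range _).bddAbove i

theorem abs_sum_mul_le {B : Mat d} {f : Fin d → ℝ} {g : ℝ} (hf : ∀ a, |f a| ≤ g)
    (hg : 0 ≤ g) (i : Fin d) : |∑ a, B i a * f a| ≤ rowSumNorm B * g := by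
  refine (Finset.abs_sum_le_sum_abs _ _).trans ?_
  refine le_trans ?_ (mul_le_mul_of_nonneg_right (sum_abs_le_rowSumNorm B i) hg)
  rw [Finset.sum_mul]
  refine Finset.sum_le_sum fun a _ => ?_
  rw [abs_mul]
  exact mul_le_mul_of_nonneg_left (hf a) (abs_nonneg _)

/-- Each contracted index costs one factor `‖B‖_∞`; the second and third powers are both below `(1 +
‖B‖_∞)³`. -/
theorem coSupNorm_act_sub_le [NeZero d] {μ μ' : Measure (PathSpace d)} (hμ : HasMoments μ)
    (hμ' : HasMoments μ') {B : Mat d} (hB : IsUnit B.det) :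
    coSupNorm (coredinates (act B μ) - coredinates (act B μ')) ≤
      (1 + rowSumNorm B) ^ 3 * momentError μ μ' := by
  set g := momentError μ μ' with hg
  have hent : ∀ ν i j, |(coredinates μ - coredinates μ') ν i j| ≤ g :=
    abs_apply_le_coSupNorm _
  have hg0 : 0 ≤ g := (abs_nonneg _).trans (hent 0 0 0)
  have hr := rowSumNorm_nonneg B
  refine coSupNorm_le fun ν i j => ?_
  refine Fin.cases ?_ (fun k => ?_) ν
  · have h1 : (coredinates (act B μ) - coredinates (act B μ')) 0 i j =
        ∑ a, B i a * ∑ b, B j b * (coredinates μ - coredinates μ') 0 a b := by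
      rw [Pi.sub_apply, Matrix.sub_apply, coredinates_zero_apply, coredinates_zero_apply,
        hμ.sigMoment_act_two hB, hμ'.sigMoment_act_two hB]
      simp_rw [Finset.mul_sum, ← Finset.sum_sub_distrib]
      refine Finset.sum_congr rfl fun a _ => Finset.sum_congr rfl fun b _ => ?_
      rw [Pi.sub_apply, Matrix.sub_apply, coredinates_zero_apply, coredinates_zero_apply]
      ring
    rw [h1]
    refine (abs_sum_mul_le (fun a => abs_sum_mul_le (fun b => hent 0 a b) hg0 j)
      (by positivity) i).trans ?_
    rw [← mul_assoc]
    refine mul_le_mul_of_nonneg_right ?_ hg0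
    nlinarith [mul_nonneg hr hr, mul_nonneg (mul_nonneg hr hr) hr]
  · have h1 : (coredinates (act B μ) - coredinates (act B μ')) k.succ i j =
        ∑ a, B i a * ∑ b, B j b * ∑ c, B k c *
          (coredinates μ - coredinates μ') c.succ a b := by
      rw [Pi.sub_apply, Matrix.sub_apply, coredinates_succ_apply, coredinates_succ_apply,
        hμ.sigMoment_act_three hB, hμ'.sigMoment_act_three hB]
      simp_rw [Finset.mul_sum, ← Finset.sum_sub_distrib]
      refine Finset.sum_congr rfl fun a _ => Finset.sum_congr rfl fun b _ =>
        Finset.sum_congr rfl fun c _ => ?_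
      rw [Pi.sub_apply, Matrix.sub_apply, coredinates_succ_apply, coredinates_succ_apply]
      ring
    rw [h1]
    refine (abs_sum_mul_le (fun a => abs_sum_mul_le (fun b => abs_sum_mul_le
      (fun c => hent c.succ a b) hg0 k) (by positivity) j) (by positivity) i).trans ?_
    rw [← mul_assoc, ← mul_assoc]
    refine mul_le_mul_of_nonneg_right ?_ hg0
    nlinarith [mul_nonneg hr hr, mul_nonneg (mul_nonneg hr hr) hr]

/-! ### The robustness constants -/

/-- Robustness constants, together with monomial factors having a controlled inverse, the latter
for all signals with existing moments of second and third order. -/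
theorem exists_robustnessConstants [NeZero d] {μS : Measure (PathSpace d)}
    (hS : IsIdentifiableSource μS) {A : Mat d} (hA : IsUnit A.det) {κ : ℝ} (hκ : 1 < κ) :
    ∃ c : Fin 5 → ℝ, IsRobustnessConstants κ μS A c ∧ ∀ ε > 0, ∀ μ, HasMoments μ →
      premetric μS μ < robustRadius c ε → ∀ θ ∈ inversion κ (act A μ), ∃ M : Mat d,
        IsMonomial M ∧ ∀ u, mv M u ≠ 0 →
          ‖mv θ (mv A u) - mv M u‖ / ‖mv M u‖ ≤ c 4 * ε := by
  obtain ⟨δ₀, hδ₀, K, hK, c₁, hc₁, c₂, hc₂, hfac⟩ :=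
    exists_factorisation_of_small_premetric hS hA hκ
  set c : Fin 5 → ℝ := ![min δ₀ 1, 1, K, c₁, c₁ * c₂] with hc
  have hpos : ∀ i, 0 < c i := by
    intro i
    fin_cases i <;> simp [hc] <;> positivity
  have hrad : ∀ ε > 0, ∀ μ, HasMoments μ → premetric μS μ < robustRadius c ε →
      ∀ θ ∈ inversion κ (act A μ), ∃ M : Mat d, IsMonomial M ∧ frobNorm M ≤ c₁ ∧
        (∀ u, ‖u‖ ≤ c₂ * ‖mv M u‖) ∧ ∃ E : Mat d, frobNorm E ≤ ε ∧
          θ = M * (1 + E) * A⁻¹ := by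
    intro ε hε μ hμ hδ θ hθ
    have hlt : premetric μS μ < δ₀ := (hδ.trans_le (min_le_left _ _)).trans_le (min_le_left _ _)
    obtain ⟨M, hM, hMle, hMinv, E, hE, rfl⟩ := hfac μ hμ hlt θ hθ
    exact ⟨M, hM, hMle, hMinv, E, hE.trans (mul_le_of_lt_robustRadius (c := c) (hpos 2)
      (min_le_right _ _) rfl (premetric_nonneg _ _) hε hδ), rfl⟩
  have hrel : ∀ ε > 0, ∀ μ, HasMoments μ → premetric μS μ < robustRadius c ε →
      ∀ θ ∈ inversion κ (act A μ), ∃ M : Mat d, IsMonomial M ∧ ∀ u, mv M u ≠ 0 →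
        ‖mv θ (mv A u) - mv M u‖ / ‖mv M u‖ ≤ c 4 * ε := by
    intro ε hε μ hμ hδ θ hθ
    obtain ⟨M, hM, hMle, hMinv, E, hE, hfac'⟩ := hrad ε hε μ hμ hδ θ hθ
    exact ⟨M, hM, fun u hu => relError_le hA hc₁.le hMle hMinv hE hfac' hu⟩
  refine ⟨c, ⟨hpos, ?_, ?_⟩, hrel⟩
  · intro ε hε μ hμ hδ θ hθ
    obtain ⟨M, hM, hMle, -, E, hE, hfac'⟩ := hrad ε hε μ hμ.hasMoments hδ θ hθ
    exact ⟨M, hM, hMle, E, hE, hfac'⟩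
  · intro ε hε μ hμ hδ
    refine iSup₂_le fun θ hθ => ?_
    obtain ⟨M, hM, hle⟩ := hrel ε hε μ hμ.hasMoments hδ θ hθ
    -- The translation `v = 0` suffices, because the relative error is bounded for all `u`,
    -- irrespective of the spatial support.
    refine iInf₂_le_of_le M hM (iInf_le_of_le 0 (iSup₂_le fun u _ => ?_))
    split_ifs with hu
    · exact zero_le
    · rw [sub_zero]
      exact ENNReal.ofReal_le_ofReal (hle u hu)

theorem IsMonomial.mv_ne_zero {M : Mat d} (hM : IsMonomial M) {u : Eucl d} (hu : u ≠ 0) :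
    mv M u ≠ 0 := by
  obtain ⟨a, σ, ha, rfl⟩ := hM
  intro h0
  refine hu ?_
  ext i
  have h1 := congrArg (fun v : Eucl d => v (σ.symm i)) h0
  simp only [mv_apply, Matrix.diagonal_mul, Equiv.Perm.permMatrix, PEquiv.toMatrix_apply] at h1
  simpa [ha] using h1

/-! ### Estimators -/

/-- An event that occurs outside of a (possibly non-measurable) set of small outer measure contains
a measurable event of large probability. -/
theorem exists_measurableSet_of_measure_le {Ω : Type*} [MeasurableSpace Ω] (P : Measure Ω)
    [IsProbabilityMeasure P] {s : Set Ω} {p : Ω → Prop} {q : ℝ} (hq1 : q ≤ 1)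
    (hs : P s ≤ ENNReal.ofReal (1 - q)) (hp : ∀ᵐ ω ∂P, p ω) :
    ∃ F : Set Ω, MeasurableSet F ∧ ENNReal.ofReal q ≤ P F ∧ ∀ ω ∈ F, ω ∉ s ∧ p ω := by
  -- The measurable hull has the same outer measure, and its complement is the required event.
  set t := toMeasurable P (s ∪ {ω | ¬ p ω})
  have ht : P t ≤ ENNReal.ofReal (1 - q) := by
    rw [measure_toMeasurable]
    refine (measure_union_le _ _).trans ?_
    rwa [ae_iff.1 hp, add_zero]
  refine ⟨tᶜ, (measurableSet_toMeasurable _ _).compl, ?_, fun ω hω => ?_⟩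
  · rw [prob_compl_eq_one_sub (measurableSet_toMeasurable _ _)]
    refine le_trans ?_ (tsub_le_tsub_left ht 1)
    rw [← ENNReal.ofReal_one, ← ENNReal.ofReal_sub _ (sub_nonneg.2 hq1)]
    exact ENNReal.ofReal_le_ofReal (by linarith)
  · have h1 : ω ∉ s ∪ {ω | ¬ p ω} := fun h => hω (subset_toMeasurable _ _ h)
    simpa using h1

/-- The estimate is `A` applied to its pullback by `A⁻¹`, so the deterministic robustness applies to
the pullback. `hrec` asks only for `HasMoments`, since nonvanishing of diagonal moments is not
inherited under a general linear map. -/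
theorem recoversWithProb_of_rate [NeZero d] {μS : Measure (PathSpace d)}
    (hS : IsIdentifiableSource μS) {A : Mat d} (hA : IsUnit A.det) {κ r ε q : ℝ} (hr : 0 ≤ r)
    (hrec : ∀ μ, HasMoments μ → premetric μS μ < r → ∀ θ ∈ inversion κ (act A μ), ∃ M : Mat d,
      IsMonomial M ∧ ∀ u, mv M u ≠ 0 → ‖mv θ (mv A u) - mv M u‖ / ‖mv M u‖ ≤ ε)
    {Ω : Type*} [MeasurableSpace Ω] (P : Measure Ω) [IsProbabilityMeasure P]
    {S X : Ω → PathSpace d} (hX : ∀ᵐ ω ∂P, ∀ t, X ω t = mv A (S ω t))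
    {est : Ω → Measure (PathSpace d)} (hest : ∀ᵐ ω ∂P, IsCoSignal (est ω)) {b : ℝ}
    (hb : (1 + rowSumNorm A⁻¹) ^ 3 * b < invModulus μS r) (hq1 : q ≤ 1)
    (hP : P {ω | b ≤ momentError (est ω) (act A μS)} ≤ ENNReal.ofReal (1 - q)) :
    RecoversWithProb P κ X S est ε q := by
  obtain ⟨F, hF, hqF, hgood⟩ := exists_measurableSet_of_measure_le P hq1 hP (hX.and hest)
  refine ⟨F, hF, hqF, fun ω hω θ hθ => ?_⟩
  obtain ⟨hlt, hXω, hco⟩ := hgood ω hω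
  rw [Set.mem_ofPred_eq, not_le] at hlt
  have hAi : IsUnit A⁻¹.det := Matrix.isUnit_nonsing_inv_det _ hA
  have hback : act A (act A⁻¹ (est ω)) = est ω := by
    rw [act_act, Matrix.mul_nonsing_inv _ hA, act_one]
  have hsrc : act A⁻¹ (act A μS) = μS := by
    rw [act_act, Matrix.nonsing_inv_mul _ hA, act_one]
  have herr := coSupNorm_act_sub_le hco.hasMoments (hS.1.hasMoments.act hA) hAi
  rw [hsrc] at herr
  have hr0 := rowSumNorm_nonneg A⁻¹
  have hδ : premetric μS (act A⁻¹ (est ω)) < r :=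
    hS.1.premetric_lt_of_coSupNorm_lt hr (herr.trans_lt
      ((mul_le_mul_of_nonneg_left hlt.le (by positivity)).trans_lt hb))
  obtain ⟨M, hM, hle⟩ := hrec _ (hco.hasMoments.act hAi) hδ θ (by rwa [hback])
  refine ⟨M, hM, iSup_le fun t => ?_⟩
  split_ifs with ht
  · exact zero_le
  · rw [hXω t]
    exact ENNReal.ofReal_le_ofReal (hle _ (hM.mv_ne_zero ht))

end SigICA

end

theorem proposition5p2 {d : ℕ} [NeZero d]
    (μS : MeasureTheory.Measure (SigICA.PathSpace d)) (hS : SigICA.IsIdentifiableSource μS)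
    (A : Matrix (Fin d) (Fin d) ℝ) (hA : IsUnit A.det) (Δκ : ℝ) (hΔκ : 0 < Δκ) :
    ∃ c : Fin 5 → ℝ,
      SigICA.IsRobustnessConstants
        (SigICA.cond2 (SigICA.unitRowUnmixing A μS) + Δκ) μS A c ∧
      ∀ (Ω : Type*) [MeasurableSpace Ω] (P : MeasureTheory.Measure Ω)
        [MeasureTheory.IsProbabilityMeasure P]
        (S X : Ω → SigICA.PathSpace d), Measurable S → P.map S = μS →
        (∀ᵐ ω ∂P, ∀ t, X ω t = SigICA.mv A (S ω t)) →
        ∀ est : ℕ → Ω → MeasureTheory.Measure (SigICA.PathSpace d),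
        (∀ n, ∀ᵐ ω ∂P, SigICA.IsCoSignal (est n ω)) →
        ∀ α : ℕ → ℝ,
        SigICA.HasRate P (fun n ω => SigICA.momentError (est n ω) (P.map X)) α →
        ∀ ε : ℝ, 0 < ε → ∀ q : ℝ, 0 ≤ q → q < 1 →
          (∃ n₀ : ℕ, ∀ n ≥ n₀,
            SigICA.RecoversWithProb P
              (SigICA.cond2 (SigICA.unitRowUnmixing A μS) + Δκ) X S (est n) ε q) ∧
          ∀ m M : ℝ,
            SigICA.IsRateConstants P
              (fun n ω => SigICA.momentError (est n ω) (P.map X)) α (1 - q) m M →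
            ∃ n₀ : ℕ,
              IsLeast {n : ℕ | m ≤ n ∧
                α n < SigICA.invModulus μS (SigICA.robustRadius c (ε / c 4)) /
                  ((1 + SigICA.rowSumNorm A⁻¹) ^ 3 * M)} n₀ ∧
              ∀ n ≥ n₀,
                SigICA.RecoversWithProb P
                  (SigICA.cond2 (SigICA.unitRowUnmixing A μS) + Δκ) X S (est n) ε q := by
  set κ := SigICA.cond2 (SigICA.unitRowUnmixing A μS) + Δκ with hκdef
  have hκ : 1 < κ := by linarith [SigICA.one_le_cond2_unitRowUnmixing hS hA]
  obtain ⟨c, hc, hrec⟩ := SigICA.exists_robustnessConstants hS hA hκ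
  refine ⟨c, hc, ?_⟩
  intro Ω _ P _ S X hSm hPS hX est hest α hrate ε hε q hq0 hq1
  have hc4 : 0 < c 4 := hc.pos 4
  have hPX : P.map X = SigICA.act A μS := by
    rw [SigICA.act, ← hPS, Measure.map_map (SigICA.measurable_pathAct A) hSm]
    refine Measure.map_congr (hX.mono fun ω hω => ?_)
    ext1 t
    exact hω t
  rw [hPX] at hrate ⊢
  have hr := SigICA.robustRadius_pos hc.pos (div_pos hε hc4)
  set r := SigICA.robustRadius c (ε / c 4)
  have hη : 0 < SigICA.invModulus μS r := by
    rw [hS.1.invModulus_eq hr.le]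
    exact div_pos hr hS.1.coNorm_standardise_onesTuple_pos
  have hrec' : ∀ μ, SigICA.HasMoments μ → SigICA.premetric μS μ < r →
      ∀ θ ∈ SigICA.inversion κ (SigICA.act A μ), ∃ M, SigICA.IsMonomial M ∧
        ∀ u, SigICA.mv M u ≠ 0 →
          ‖SigICA.mv θ (SigICA.mv A u) - SigICA.mv M u‖ / ‖SigICA.mv M u‖ ≤ ε := by
    have h := hrec (ε / c 4) (div_pos hε hc4)
    -- Robustness at level `ε / c₄` gives relative error `c₄ (ε / c₄) = ε`.
    rwa [mul_div_cancel₀ _ hc4.ne'] at h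
  have hrow := SigICA.rowSumNorm_nonneg A⁻¹
  have hmain : ∀ m M : ℝ, SigICA.IsRateConstants P
      (fun n ω => SigICA.momentError (est n ω) (SigICA.act A μS)) α (1 - q) m M →
      ∃ n₀ : ℕ, IsLeast {n : ℕ | m ≤ n ∧
        α n < SigICA.invModulus μS r / ((1 + SigICA.rowSumNorm A⁻¹) ^ 3 * M)} n₀ ∧
        ∀ n ≥ n₀, SigICA.RecoversWithProb P κ X S (est n) ε q := by
    rintro m M ⟨hm, hM, hP⟩
    have hden : 0 < (1 + SigICA.rowSumNorm A⁻¹) ^ 3 * M := by positivity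
    have hne : ∃ n : ℕ, m ≤ n ∧
        α n < SigICA.invModulus μS r / ((1 + SigICA.rowSumNorm A⁻¹) ^ 3 * M) :=
      ((tendsto_natCast_atTop_atTop.eventually_ge_atTop m).and
        (hrate.2.1.eventually_lt_const (div_pos hη hden))).exists
    classical
    refine ⟨Nat.find hne, ⟨Nat.find_spec hne, fun n hn => Nat.find_min' hne hn⟩, ?_⟩
    intro n hn
    obtain ⟨hm₀, hα₀⟩ := Nat.find_spec hne
    have hmn : m ≤ n := hm₀.trans (by exact_mod_cast hn)
    -- Monotonicity of the rate carries the inequality at the least index over to all later ones.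
    have hαn := (hrate.1.antitone hn).trans_lt hα₀
    rw [lt_div_iff₀ hden] at hαn
    exact SigICA.recoversWithProb_of_rate hS hA hr.le hrec' P hX (hest n)
      (b := M * α n) (by linarith) hq1.le (hP n hmn)
  refine ⟨?_, hmain⟩
  obtain ⟨m, M, hmM⟩ := hrate.2.2 (1 - q) (by linarith)
  obtain ⟨n₀, -, h⟩ := hmain m M hmM
  exact ⟨n₀, h⟩
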